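/- Let $\mathcal M=(\mathcal S,\mathcal A,\mathcal R,p)$ be a finite MDP ($\mathcal S,\mathcal A$ nonempty finite sets of states and actions, $\mathcal R\subset\mathbb R$ a finite set of rewards, $p(s',r\mid s,a)$ the dynamics) and let $\mathcal O$ be a nonempty finite set of options. Each option $o$ has a policy $\pi(a\mid s,o)$ and termination probabilities $\beta(s,o)\in[0,1]$, and may be initiated in every state: started in $s$, it chooses actions from $\pi(\cdot\mid\cdot,o)$ and, on each arrival in a state $s'$, terminates with probability $\beta(s',o)$. Assume that the expected length of every option from every state is finite (in particular, it terminates almost surely). A policy $\mu(o\mid s)$ is a stationary randomized choice of an option in each state; whenever an option terminates in $s'$, the next one is drawn from $\mu(\cdot\mid s')$. Let $\Pi$ be the set of all such policies. Unichain assumption: for every $\mu\in\Pi$, the Markov chain on $\mathcal S$ of the states $\hat S_0,\hat S_1,\dots$ in which successive options are initiated has exactly one recurrent class (and possibly transient states). Let $\hat R_i,\hat L_i$ be the cumulative reward and the length of the $i$-th option, and $r(\mu)=\lim_{n\to\infty}\mathbb E_\mu[\sum_{i=0}^n\hat R_i\mid \hat S_0=s,\hat O_0=o]\,/\,\mathbb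 E_\mu[\sum_{i=0}^n\hat L_i\mid \hat S_0=s,\hat O_0=o]$, which exists, does not depend on $(s,o)$, and equals $\lim_{t\to\infty}\frac1t\mathbb E_\mu[\sum_{i=1}^tR_i\mid S_0=s,O_0=o]$; let $r_*=\sup_{\mu\in\Pi}r(\mu)<\infty$. Let $q_\mu(s,o)=\sum_{t\ge1}\mathbb E_\mu[R_t-r(\mu)\mid S_0=s,O_0=o]$, the series being summed in the sense of Cesàro (this sum exists). For $q\in\mathbb R^{\mathcal S\times\mathcal O}$, $\bar r\in\mathbb R$ consider the intra-option Bellman equation $$q(s,o)=\sum_a\pi(a\mid s,o)\sum_{s',r}p(s',r\mid s,a)\big(r-\bar r+u^q(s',o)\big)\quad\text{for all }s,o,$$ where in the optimality equation $u^q(s',o)=(1-\beta(s',o))q(s',o)+\beta(s',o)\max_{o'}q(s',o')$, and in the evaluation equation for $\mu$ $u^q(s',o)=(1-\beta(s',o))q(s',o)+\beta(s',o)\sum_{o'}\mu(o'\mid s')q(s',o')$. Let $e$ be the all-one vector. Then: 1. (a) The optimality equation has a solution $(\bar r,q)$. (b) Every solution has $\bar r=r_*$, and if $q_1$ is one solution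 for $q$, then the set of all solutions for $q$ is $\{q_1+ce\mid c\in\mathbb R\}$. (c) If $q$ is a solution and $\mu\in\Pi$ is greedy with respect to $q$ (that is, $\mu(o\mid s)>0$ implies $q(s,o)=\max_{o'}q(s,o')$), then $r(\mu)=r_*$. 2. For every $\mu\in\Pi$: (a) the evaluation equation for $\mu$ has a solution $(\bar r,q)$. (b) Every solution has $\bar r=r(\mu)$, and the set of all solutions for $q$ is $\{q_\mu+ce\mid c\in\mathbb R\}$. -/

import Mathlib

open Filter Topology

noncomputable section

namespace AvgOptions

/-- A finite Markov decision process with states `S`, actions `A`, a finite set of real rewards,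
and dynamics `p s a s' r`, the probability of next state `s'` and reward `r`. -/
structure FiniteMDP (S A : Type*) [Fintype S] [Fintype A] where
  rewards : Finset ℝ
  p : S → A → S → rewards → ℝ
  p_nonneg : ∀ s a s' r, 0 ≤ p s a s' r
  p_sum : ∀ s a, ∑ s', ∑ r, p s a s' r = 1

/-- An option: a stochastic policy `pi s a` over actions, and the probability `beta s` that the
option terminates on arrival in the state `s`. It may be initiated in every state. -/
structure TemporalOption (S A : Type*) [Fintype A] where
  pi : S → A → ℝ
  pi_nonneg : ∀ s a, 0 ≤ pi s a
  pi_sum : ∀ s, ∑ a, pi s a = 1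
  beta : S → ℝ
  beta_nonneg : ∀ s, 0 ≤ beta s
  beta_le_one : ∀ s, beta s ≤ 1

/-- A (stationary, randomized) policy over options; `prob s o` is the probability of choosing
the option `o` in the state `s`. -/
structure Policy (S O : Type*) [Fintype O] where
  prob : S → O → ℝ
  prob_nonneg : ∀ s o, 0 ≤ prob s o
  prob_sum : ∀ s, ∑ o, prob s o = 1

variable {S A O : Type*} [Fintype S] [Fintype A] [Fintype O]

/-! ### Execution of a single option until termination -/

/-- The probability that the option `w`, initiated in `s`, runs for exactly `l + 1` steps and
produces the successive actions, next states and rewards listed in `τ`. -/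
def execProb (M : FiniteMDP S A) (w : TemporalOption S A) :
    (l : ℕ) → S → (Fin (l + 1) → A × S × M.rewards) → ℝ
  | 0, s, τ =>
      w.pi s (τ 0).1 * M.p s (τ 0).1 (τ 0).2.1 (τ 0).2.2 * w.beta (τ 0).2.1
  | l + 1, s, τ =>
      w.pi s (τ 0).1 * M.p s (τ 0).1 (τ 0).2.1 (τ 0).2.2 * (1 - w.beta (τ 0).2.1) *
        execProb M w l (τ 0).2.1 (Fin.tail τ)

/-- The probability that the option `w`, initiated in `s`, has length exactly `l + 1`. -/
def lengthProb (M : FiniteMDP S A) (w : TemporalOption S A) (s : S) (l : ℕ) : ℝ :=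
  ∑ τ : Fin (l + 1) → A × S × M.rewards, execProb M w l s τ

/-- The length of the option `w`, initiated in `s`, is almost surely finite and has a finite
expectation. -/
def FiniteMeanLength (M : FiniteMDP S A) (w : TemporalOption S A) (s : S) : Prop :=
  HasSum (fun l => lengthProb M w s l) 1 ∧
    Summable (fun l : ℕ => ((l : ℝ) + 1) * lengthProb M w s l)

/-- The probability that the option `w`, initiated in `s`, terminates in `s'`. -/
def termProb [DecidableEq S] (M : FiniteMDP S A) (w : TemporalOption S A) (s s' : S) : ℝ :=
  ∑' l : ℕ, ∑ τ : Fin (l + 1) → A × S × M.rewards,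
    execProb M w l s τ * (if (τ (Fin.last l)).2.1 = s' then 1 else 0)

/-- The expected cumulative reward during the execution of `w` initiated in `s`. -/
def meanOptionReward (M : FiniteMDP S A) (w : TemporalOption S A) (s : S) : ℝ :=
  ∑' l : ℕ, ∑ τ : Fin (l + 1) → A × S × M.rewards,
    execProb M w l s τ * ∑ i, ((τ i).2.2 : ℝ)

/-- The expected length of the execution of `w` initiated in `s`. -/
def meanOptionLength (M : FiniteMDP S A) (w : TemporalOption S A) (s : S) : ℝ :=
  ∑' l : ℕ, ((l : ℝ) + 1) * lengthProb M w s l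

/-! ### The unichain condition -/

/-- `C` is a recurrent class of the finite Markov chain with transition matrix `K`:
a nonempty closed set of states that all communicate with each other. -/
def IsRecurrentClass [DecidableEq S] (K : Matrix S S ℝ) (C : Set S) : Prop :=
  C.Nonempty ∧ (∀ s ∈ C, ∀ s' ∉ C, K s s' = 0) ∧
    ∀ s ∈ C, ∀ s' ∈ C, ∃ n : ℕ, 0 < (K ^ n) s s'

/-- Exactly one recurrent class (all other states being transient). -/
def IsUnichain [DecidableEq S] (K : Matrix S S ℝ) : Prop :=
  ∃! C : Set S, IsRecurrentClass K C

/-- The Markov chain of the states in which successive options are initiated when options are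
chosen by `μ`. -/
def inducedChain [DecidableEq S] (M : FiniteMDP S A) (opt : O → TemporalOption S A)
    (μ : Policy S O) : Matrix S S ℝ :=
  fun s s' => ∑ o, μ.prob s o * termProb M (opt o) s s'

/-! ### Reward rate -/

/-- Transition matrix of (initiation state, option) from one option to the next. -/
def decisionChain [DecidableEq S] (M : FiniteMDP S A) (opt : O → TemporalOption S A)
    (μ : Policy S O) : Matrix (S × O) (S × O) ℝ :=
  fun x y => termProb M (opt x.2) x.1 y.1 * μ.prob y.1 y.2

/-- The ratio of the expected total reward to the expected total length of the options number
`0, …, n`, when the first option is `o`, initiated in `s`. -/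
def optionRatio [DecidableEq S] [DecidableEq O] (M : FiniteMDP S A)
    (opt : O → TemporalOption S A) (μ : Policy S O) (s : S) (o : O) (n : ℕ) : ℝ :=
  (∑ i ∈ Finset.range (n + 1), ∑ y : S × O,
      (decisionChain M opt μ ^ i) (s, o) y * meanOptionReward M (opt y.2) y.1) /
    (∑ i ∈ Finset.range (n + 1), ∑ y : S × O,
      (decisionChain M opt μ ^ i) (s, o) y * meanOptionLength M (opt y.2) y.1)

/-- The reward rate of `μ` from the initial state `s` and initial option `o`. -/
def rewardRateFrom [DecidableEq S] [DecidableEq O] (M : FiniteMDP S A)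
    (opt : O → TemporalOption S A) (μ : Policy S O) (s : S) (o : O) : ℝ :=
  limUnder atTop (optionRatio M opt μ s o)

/-- The reward rate `r(μ)`, read off at some initial state and option; the initial pair is
immaterial where the reward rate does not depend on it. -/
def rewardRate [DecidableEq S] [DecidableEq O] [Nonempty S] [Nonempty O] (M : FiniteMDP S A)
    (opt : O → TemporalOption S A) (μ : Policy S O) : ℝ :=
  rewardRateFrom M opt μ (Classical.arbitrary S) (Classical.arbitrary O)

/-- The optimal reward rate. -/
def optimalRate [DecidableEq S] [DecidableEq O] [Nonempty S] [Nonempty O] (M : FiniteMDP S A)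
    (opt : O → TemporalOption S A) : ℝ :=
  ⨆ μ : Policy S O, rewardRate M opt μ

/-! ### The process at the level of single time steps -/

/-- Given state `s` and executing option `o`, the probability of action `a`, next state `s'`,
reward `r` and next executing option `o'`, where `z = (a, s', r, o')`: the option `o` terminates
in `s'` and `μ` chooses `o'`, or it continues and `o' = o`. -/
def stepProb [DecidableEq O] (M : FiniteMDP S A) (opt : O → TemporalOption S A)
    (μ : Policy S O) (s : S) (o : O) (z : A × S × M.rewards × O) : ℝ :=
  (opt o).pi s z.1 * M.p s z.1 z.2.1 z.2.2.1 *
    ((opt o).beta z.2.1 * μ.prob z.2.1 z.2.2.2 +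
      (1 - (opt o).beta z.2.1) * (if z.2.2.2 = o then 1 else 0))

/-- The probability of the trajectory `τ` of the first `n` steps, started at `(s, o)`. -/
def trajProb [DecidableEq O] (M : FiniteMDP S A) (opt : O → TemporalOption S A)
    (μ : Policy S O) : (n : ℕ) → S → O → (Fin n → A × S × M.rewards × O) → ℝ
  | 0, _, _, _ => 1
  | n + 1, s, o, τ =>
      stepProb M opt μ s o (τ 0) *
        trajProb M opt μ n (τ 0).2.1 (τ 0).2.2.2 (Fin.tail τ)

/-- The expectation of `R₁ - c + ⋯ + Rₙ - c`, started at `(s, o)`. -/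
def expectedReturn [DecidableEq O] (M : FiniteMDP S A) (opt : O → TemporalOption S A)
    (μ : Policy S O) (c : ℝ) (s : S) (o : O) (n : ℕ) : ℝ :=
  ∑ τ : Fin n → A × S × M.rewards × O,
    trajProb M opt μ n s o τ * ∑ i, (((τ i).2.2.1 : ℝ) - c)

/-- The averages of the first partial sums of the series
`𝔼[R₁ - r(μ)] + 𝔼[R₂ - r(μ)] + ⋯`, started at `(s, o)`. -/
def cesaroReturn [DecidableEq S] [DecidableEq O] [Nonempty S] [Nonempty O]
    (M : FiniteMDP S A) (opt : O → TemporalOption S A) (μ : Policy S O) (s : S) (o : O)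
    (N : ℕ) : ℝ :=
  (∑ n ∈ Finset.Icc 1 N, expectedReturn M opt μ (rewardRate M opt μ) s o n) / N

/-- The differential option-value function `q_μ`: the sum of the above series, in the sense of
Cesàro (the ordinary sum wherever the series converges; it need not for periodic chains). -/
def diffValue [DecidableEq S] [DecidableEq O] [Nonempty S] [Nonempty O]
    (M : FiniteMDP S A) (opt : O → TemporalOption S A) (μ : Policy S O) (s : S) (o : O) : ℝ :=
  limUnder atTop (cesaroReturn M opt μ s o)

/-! ### Intra-option Bellman equations -/

/-- The general intra-option equation, for given `u s' o`. -/
def IntraOptionEq (M : FiniteMDP S A) (opt : O → TemporalOption S A)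
    (u : S → O → ℝ) (rbar : ℝ) (q : S → O → ℝ) : Prop :=
  ∀ s o, q s o = ∑ a, (opt o).pi s a * ∑ s', ∑ r : M.rewards,
    M.p s a s' r * ((r : ℝ) - rbar + u s' o)

def uOpt [Nonempty O] (opt : O → TemporalOption S A) (q : S → O → ℝ) (s' : S) (o : O) : ℝ :=
  (1 - (opt o).beta s') * q s' o +
    (opt o).beta s' * Finset.univ.sup' Finset.univ_nonempty (fun o' => q s' o')

def uEval (opt : O → TemporalOption S A) (μ : Policy S O) (q : S → O → ℝ) (s' : S) (o : O) : ℝ :=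
  (1 - (opt o).beta s') * q s' o + (opt o).beta s' * ∑ o', μ.prob s' o' * q s' o'

/-- `(rbar, q)` solves the intra-option optimality equation. -/
def OptimalityEq [Nonempty O] (M : FiniteMDP S A) (opt : O → TemporalOption S A)
    (rbar : ℝ) (q : S → O → ℝ) : Prop :=
  IntraOptionEq M opt (uOpt opt q) rbar q

/-- `(rbar, q)` solves the intra-option evaluation equation for `μ`. -/
def EvaluationEq (M : FiniteMDP S A) (opt : O → TemporalOption S A) (μ : Policy S O)
    (rbar : ℝ) (q : S → O → ℝ) : Prop :=
  IntraOptionEq M opt (uEval opt μ q) rbar q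

/-- `μ` chooses only options that maximize `q s ·`. -/
def IsGreedy (μ : Policy S O) (q : S → O → ℝ) : Prop :=
  ∀ s o, 0 < μ.prob s o → ∀ o', q s o' ≤ q s o

end AvgOptions

end

open AvgOptions

namespace AvgOptions

noncomputable section

/-! The argument passes between two time scales. Since an option terminates almost surely, a
function harmonic for its transitions killed at termination vanishes. Hence a solution of an
option's one-step equation with terminal values `f` is forced to be mean reward minus `c` times mean
length plus the mean of `f` at termination (`eq_option_model`), which turns the intra-option
equations into semi-Markov equations between decision epochs.

For a fixed `μ`, the evaluation equation is the Poisson equation of the chain `intraStep` on pairs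
(state, executing option). By the unichain condition its harmonic functions are constant
(`intraStep_harmonic_const`), so rank-nullity solves it (`exists_poisson`). Any solution `(c, q)`
makes rewards a coboundary plus `c`. Telescoping leaves bounded remainders, so both reward averages
tend to `c`, and the Cesàro means of the returns tend to `q` minus a constant.

For the optimality equation, existence is by vanishing discount (`exists_optimalityEq`). Iterating
`uEval ≤ uOpt` bounds every reward rate by `c`, and a greedy policy attains it. For two solutions,
the difference of their maximal values is subharmonic under one greedy policy and superharmonic
under the other; were it not constant, a policy mixing the two would have two recurrent classes
(`exists_const_of_sub_super`). -/

theorem sum_fin_succ_fun {Z : Type*} [Fintype Z] (n : ℕ) (f : (Fin (n + 1) → Z) → ℝ) :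
    ∑ τ, f τ = ∑ z, ∑ τ : Fin n → Z, f (Fin.cons z τ) := by
  rw [← Fintype.sum_prod_type']
  exact (Fintype.sum_equiv (Fin.consEquiv fun _ => Z) _ _ fun _ => rfl).symm

/-! ### Running one option until termination -/

section Execution

variable {S A : Type*} [Fintype S] [Fintype A] (M : FiniteMDP S A) (w : TemporalOption S A)

/-- The state transition matrix under the policy of the option `w`. -/
def trans : Matrix S S ℝ := fun s s' => ∑ a, w.pi s a * ∑ r, M.p s a s' r

/-- The expected one-step reward under the policy of the option `w`. -/
def stepReward (s : S) : ℝ := ∑ a, w.pi s a * ∑ s', ∑ r : M.rewards, M.p s a s' r * (r : ℝ)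

theorem trans_nonneg (s s' : S) : 0 ≤ trans M w s s' :=
  Finset.sum_nonneg fun a _ => mul_nonneg (w.pi_nonneg s a)
    (Finset.sum_nonneg fun r _ => M.p_nonneg s a s' r)

theorem sum_step_mul (s : S) (g : S → ℝ) :
    ∑ z : A × S × M.rewards, w.pi s z.1 * M.p s z.1 z.2.1 z.2.2 * g z.2.1 =
      ∑ s', trans M w s s' * g s' := by
  simp only [Fintype.sum_prod_type, trans, Finset.sum_mul, Finset.mul_sum]
  rw [Finset.sum_comm]

theorem sum_step_reward (s : S) :
    ∑ z : A × S × M.rewards, w.pi s z.1 * M.p s z.1 z.2.1 z.2.2 * (z.2.2 : ℝ) =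
      stepReward M w s := by
  simp only [Fintype.sum_prod_type, stepReward, Finset.mul_sum, mul_assoc]

theorem trans_sum (s : S) : ∑ s', trans M w s s' = 1 := by
  simp only [trans]
  rw [Finset.sum_comm]
  simp only [← Finset.mul_sum, M.p_sum, mul_one, w.pi_sum]

theorem sum_trans_beta (s : S) :
    ∑ x, trans M w s x * w.beta x + ∑ x, trans M w s x * (1 - w.beta x) = 1 := by
  simp only [mul_sub, mul_one, Finset.sum_sub_distrib, trans_sum]
  ring

omit [Fintype S] in
theorem one_sub_beta_nonneg (s : S) : 0 ≤ 1 - w.beta s := sub_nonneg.2 (w.beta_le_one s)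

/-- With `sum_execProb_succ`, this conditions on the first step for an arbitrary functional `G`.
Taking for `G` the constant 1, the indicator of the final state and the total reward gives all
recursions below. -/
theorem sum_execProb_zero (s : S) (G : (Fin 1 → A × S × M.rewards) → ℝ) :
    ∑ τ, execProb M w 0 s τ * G τ =
      ∑ z : A × S × M.rewards, w.pi s z.1 * M.p s z.1 z.2.1 z.2.2 *
        (w.beta z.2.1 * G fun _ => z) := by
  refine Fintype.sum_equiv (Equiv.funUnique (Fin 1) _) _ _ fun τ => ?_
  have : (fun _ => τ 0) = τ := by
    funext i
    rw [Subsingleton.elim i 0]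
  simp [execProb, this, mul_assoc]

theorem sum_execProb_succ (l : ℕ) (s : S) (G : (Fin (l + 2) → A × S × M.rewards) → ℝ) :
    ∑ τ, execProb M w (l + 1) s τ * G τ =
      ∑ z : A × S × M.rewards, w.pi s z.1 * M.p s z.1 z.2.1 z.2.2 * ((1 - w.beta z.2.1) *
        ∑ τ : Fin (l + 1) → A × S × M.rewards,
          execProb M w l z.2.1 τ * G (Fin.cons z τ)) := by
  rw [sum_fin_succ_fun]
  refine Finset.sum_congr rfl fun z _ => ?_
  simp only [Finset.mul_sum]
  refine Finset.sum_congr rfl fun τ _ => ?_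
  simp only [execProb, Fin.cons_zero, Fin.tail_cons]
  ring

theorem execProb_nonneg (l : ℕ) (s : S) (τ : Fin (l + 1) → A × S × M.rewards) :
    0 ≤ execProb M w l s τ := by
  induction l generalizing s with
  | zero => exact mul_nonneg (mul_nonneg (w.pi_nonneg _ _) (M.p_nonneg _ _ _ _)) (w.beta_nonneg _)
  | succ l ih =>
    exact mul_nonneg (mul_nonneg (mul_nonneg (w.pi_nonneg _ _) (M.p_nonneg _ _ _ _))
      (one_sub_beta_nonneg w _)) (ih _ _)

theorem lengthProb_nonneg (s : S) (l : ℕ) : 0 ≤ lengthProb M w s l :=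
  Finset.sum_nonneg fun _ _ => execProb_nonneg M w _ _ _

theorem lengthProb_zero (s : S) :
    lengthProb M w s 0 = ∑ s', trans M w s s' * w.beta s' := by
  have h := sum_execProb_zero M w s fun _ => 1
  simp only [mul_one] at h
  rw [lengthProb, h, sum_step_mul M w s w.beta]

theorem lengthProb_succ (s : S) (l : ℕ) :
    lengthProb M w s (l + 1) =
      ∑ s', trans M w s s' * ((1 - w.beta s') * lengthProb M w s' l) := by
  have h := sum_execProb_succ M w l s fun _ => 1
  simp only [mul_one] at h
  rw [lengthProb, h]
  exact sum_step_mul M w s fun s' => (1 - w.beta s') * lengthProb M w s' l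

/-- The probability that `w`, initiated in `s`, has length `l + 1` and terminates in `s'`. -/
def endProb [DecidableEq S] (s s' : S) (l : ℕ) : ℝ :=
  ∑ τ : Fin (l + 1) → A × S × M.rewards,
    execProb M w l s τ * (if (τ (Fin.last l)).2.1 = s' then 1 else 0)

/-- The expected cumulative reward of `w`, initiated in `s`, on the event of length `l + 1`. -/
def lengthReward (s : S) (l : ℕ) : ℝ :=
  ∑ τ : Fin (l + 1) → A × S × M.rewards, execProb M w l s τ * ∑ i, ((τ i).2.2 : ℝ)

theorem endProb_zero [DecidableEq S] (s s' : S) :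
    endProb M w s s' 0 =
      ∑ x, trans M w s x * (w.beta x * if x = s' then 1 else 0) := by
  rw [endProb, sum_execProb_zero]
  exact sum_step_mul M w s fun x => w.beta x * if x = s' then 1 else 0

theorem endProb_succ [DecidableEq S] (s s' : S) (l : ℕ) :
    endProb M w s s' (l + 1) =
      ∑ x, trans M w s x * ((1 - w.beta x) * endProb M w x s' l) := by
  rw [endProb, sum_execProb_succ]
  simp only [← Fin.succ_last, Fin.cons_succ]
  exact sum_step_mul M w s fun x => (1 - w.beta x) * endProb M w x s' l

theorem endProb_nonneg [DecidableEq S] (s s' : S) (l : ℕ) : 0 ≤ endProb M w s s' l :=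
  Finset.sum_nonneg fun _ _ => mul_nonneg (execProb_nonneg M w _ _ _) (by split_ifs <;> simp)

theorem sum_endProb [DecidableEq S] (s : S) (l : ℕ) :
    ∑ s', endProb M w s s' l = lengthProb M w s l := by
  simp only [endProb, lengthProb]
  rw [Finset.sum_comm]
  simp

theorem lengthReward_zero (s : S) :
    lengthReward M w s 0 = ∑ z : A × S × M.rewards,
      w.pi s z.1 * M.p s z.1 z.2.1 z.2.2 * (w.beta z.2.1 * (z.2.2 : ℝ)) := by
  rw [lengthReward, sum_execProb_zero]
  simp

/-- The sum stays over full triples because the first reward and the next state are correlated; the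
first reward is weighted by the probability of the remaining length. -/
theorem lengthReward_succ (s : S) (l : ℕ) :
    lengthReward M w s (l + 1) = ∑ z : A × S × M.rewards,
      w.pi s z.1 * M.p s z.1 z.2.1 z.2.2 * ((1 - w.beta z.2.1) *
        ((z.2.2 : ℝ) * lengthProb M w z.2.1 l + lengthReward M w z.2.1 l)) := by
  rw [lengthReward, sum_execProb_succ]
  refine Finset.sum_congr rfl fun z _ => ?_
  congr 2
  simp only [Fin.sum_univ_succ (n := l + 1), Fin.cons_zero, Fin.cons_succ, mul_add,
    Finset.sum_add_distrib]
  rw [lengthProb, lengthReward, Finset.mul_sum]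
  congr 1
  exact Finset.sum_congr rfl fun τ _ => mul_comm _ _

theorem exists_reward_bound : ∃ B : ℝ, 0 ≤ B ∧ ∀ r : M.rewards, |(r : ℝ)| ≤ B :=
  ⟨∑ r : M.rewards, |(r : ℝ)|, Finset.sum_nonneg fun _ _ => abs_nonneg _, fun r =>
    Finset.single_le_sum (f := fun r : M.rewards => |(r : ℝ)|) (fun _ _ => abs_nonneg _)
      (Finset.mem_univ r)⟩

/-- Rewards are bounded, so finite mean length dominates the reward series. -/
theorem abs_lengthReward_le {B : ℝ} (hB : ∀ r : M.rewards, |(r : ℝ)| ≤ B) (s : S) (l : ℕ) :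
    |lengthReward M w s l| ≤ B * (((l : ℝ) + 1) * lengthProb M w s l) := by
  rw [lengthReward, lengthProb, Finset.mul_sum, Finset.mul_sum]
  refine (Finset.abs_sum_le_sum_abs _ _).trans (Finset.sum_le_sum fun τ _ => ?_)
  rw [abs_mul, abs_of_nonneg (execProb_nonneg M w l s τ)]
  have : |∑ i, ((τ i).2.2 : ℝ)| ≤ ((l : ℝ) + 1) * B := by
    refine (Finset.abs_sum_le_sum_abs _ _).trans
      ((Finset.sum_le_sum fun i _ => hB (τ i).2.2).trans ?_)
    simp
  calc execProb M w l s τ * |∑ i, ((τ i).2.2 : ℝ)|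
      ≤ execProb M w l s τ * (((l : ℝ) + 1) * B) :=
        mul_le_mul_of_nonneg_left this (execProb_nonneg M w l s τ)
    _ = _ := by ring

theorem termProb_nonneg [DecidableEq S] (s s' : S) : 0 ≤ termProb M w s s' :=
  tsum_nonneg (endProb_nonneg M w s s')

variable (hlen : ∀ s, FiniteMeanLength M w s)
include hlen

theorem summable_endProb [DecidableEq S] (s s' : S) : Summable (endProb M w s s') := by
  refine Summable.of_nonneg_of_le (endProb_nonneg M w s s') (fun l => ?_) (hlen s).1.summable
  rw [← sum_endProb]
  exact Finset.single_le_sum (f := fun x => endProb M w s x l)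
    (fun x _ => endProb_nonneg M w s x l) (Finset.mem_univ s')

theorem summable_lengthReward (s : S) : Summable (lengthReward M w s) := by
  obtain ⟨B, -, hB⟩ := exists_reward_bound M
  exact Summable.of_norm_bounded ((hlen s).2.mul_left B) fun l => abs_lengthReward_le M w hB s l

theorem termProb_sum [DecidableEq S] (s : S) : ∑ s', termProb M w s s' = 1 := by
  have h : ∀ s', termProb M w s s' = ∑' l, endProb M w s s' l := fun _ => rfl
  simp only [h]
  rw [← Summable.tsum_finsetSum fun s' _ => summable_endProb M w hlen s s']
  simp only [sum_endProb]
  exact (hlen s).1.tsum_eq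

theorem termProb_eq [DecidableEq S] (s s' : S) :
    termProb M w s s' = ∑ x, trans M w s x *
      ((1 - w.beta x) * termProb M w x s' + w.beta x * if x = s' then 1 else 0) := by
  have h : ∀ s, termProb M w s s' = ∑' l, endProb M w s s' l := fun _ => rfl
  simp only [h]
  rw [(summable_endProb M w hlen s s').tsum_eq_zero_add, endProb_zero]
  simp only [endProb_succ]
  rw [Summable.tsum_finsetSum fun x _ =>
    ((summable_endProb M w hlen x s').mul_left _).mul_left _, ← Finset.sum_add_distrib]
  refine Finset.sum_congr rfl fun x _ => ?_
  rw [tsum_mul_left, tsum_mul_left]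
  ring

theorem meanOptionLength_eq (s : S) :
    meanOptionLength M w s =
      1 + ∑ x, trans M w s x * ((1 - w.beta x) * meanOptionLength M w x) := by
  -- The first step lengthens every continuation by one, and the continuation's length probabilities
  -- sum to 1.
  have h1 : ∀ x, ∑' l : ℕ, (((l : ℝ) + 1) + 1) * lengthProb M w x l =
      meanOptionLength M w x + 1 := fun x => by
    have h := (hlen x).2.tsum_add (hlen x).1.summable
    rw [(hlen x).1.tsum_eq] at h
    rw [meanOptionLength, ← h]
    exact tsum_congr fun l => by ring
  have h2 : ∀ x, Summable fun l : ℕ => (((l : ℝ) + 1) + 1) * lengthProb M w x l := fun x =>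
    ((hlen x).2.add (hlen x).1.summable).congr fun l => by ring
  rw [meanOptionLength, (hlen s).2.tsum_eq_zero_add, lengthProb_zero]
  have h3 : ∀ l : ℕ, (((l + 1 : ℕ) : ℝ) + 1) * lengthProb M w s (l + 1) =
      ∑ x, trans M w s x * ((1 - w.beta x) * ((((l : ℝ) + 1) + 1) * lengthProb M w x l)) :=
    fun l => by
      rw [lengthProb_succ, Finset.mul_sum]
      refine Finset.sum_congr rfl fun x _ => ?_
      push_cast
      ring
  simp only [h3]
  rw [Summable.tsum_finsetSum fun x _ => ((h2 x).mul_left _).mul_left _]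
  simp only [tsum_mul_left, h1]
  have h4 := sum_trans_beta M w s
  simp only [Nat.cast_zero, zero_add, one_mul, mul_add, mul_one, Finset.sum_add_distrib]
  linarith

theorem one_le_meanOptionLength (s : S) : 1 ≤ meanOptionLength M w s := by
  rw [← (hlen s).1.tsum_eq]
  refine (hlen s).1.summable.tsum_le_tsum (fun l => ?_) (hlen s).2
  have := lengthProb_nonneg M w s l
  have : (0 : ℝ) ≤ l := l.cast_nonneg
  nlinarith

theorem meanOptionReward_eq (s : S) :
    meanOptionReward M w s =
      stepReward M w s + ∑ x, trans M w s x * ((1 - w.beta x) * meanOptionReward M w x) := by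
  have h : ∀ x, meanOptionReward M w x = ∑' l, lengthReward M w x l := fun _ => rfl
  simp only [h]
  have h1 : ∀ z : A × S × M.rewards, HasSum (fun l => w.pi s z.1 * M.p s z.1 z.2.1 z.2.2 *
      ((1 - w.beta z.2.1) *
        ((z.2.2 : ℝ) * lengthProb M w z.2.1 l + lengthReward M w z.2.1 l)))
      (w.pi s z.1 * M.p s z.1 z.2.1 z.2.2 * ((1 - w.beta z.2.1) *
        ((z.2.2 : ℝ) * 1 + ∑' l, lengthReward M w z.2.1 l))) := fun z =>
    ((((hlen z.2.1).1.mul_left _).add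
      (summable_lengthReward M w hlen z.2.1).hasSum).mul_left _).mul_left _
  have h2 := (hasSum_sum (s := Finset.univ) fun z _ => h1 z).tsum_eq
  simp only [← lengthReward_succ] at h2
  rw [(summable_lengthReward M w hlen s).tsum_eq_zero_add, lengthReward_zero, h2,
    ← sum_step_reward M w s,
    ← sum_step_mul M w s fun x => (1 - w.beta x) * ∑' l, lengthReward M w x l,
    ← Finset.sum_add_distrib, ← Finset.sum_add_distrib]
  exact Finset.sum_congr rfl fun z _ => by ring

/-- A function that is harmonic for the option's transitions killed at termination vanishes. -/
theorem eq_zero_of_killed_harmonic (h : S → ℝ)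
    (hh : ∀ s, h s = ∑ x, trans M w s x * ((1 - w.beta x) * h x)) (s : S) : h s = 0 := by
  obtain ⟨B, hB⟩ : ∃ B, ∀ x, |h x| ≤ B :=
    ⟨∑ x, |h x|, fun x => Finset.single_le_sum (f := fun x => |h x|) (fun _ _ => abs_nonneg _)
      (Finset.mem_univ x)⟩
  -- The factor of `B` is the probability that the length exceeds `n`: harmonicity is iterated `n`
  -- times on the surviving paths, and survival tends to 0.
  have key : ∀ n : ℕ, ∀ x, |h x| ≤ B * (1 - ∑ l ∈ Finset.range n, lengthProb M w x l) := by
    intro n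
    induction n with
    | zero => simpa using hB
    | succ n ih =>
      intro x
      have h1 : B * (1 - ∑ l ∈ Finset.range (n + 1), lengthProb M w x l) =
          ∑ y, trans M w x y * ((1 - w.beta y) *
            (B * (1 - ∑ l ∈ Finset.range n, lengthProb M w y l))) := by
        rw [Finset.sum_range_succ', lengthProb_zero]
        simp only [lengthProb_succ]
        rw [Finset.sum_comm]
        have h4 := sum_trans_beta M w x
        have h5 : ∀ y, trans M w x y * ((1 - w.beta y) *
            (B * (1 - ∑ l ∈ Finset.range n, lengthProb M w y l))) =
            B * (trans M w x y * (1 - w.beta y)) - B * ∑ l ∈ Finset.range n,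
              trans M w x y * ((1 - w.beta y) * lengthProb M w y l) := fun y => by
          simp only [← Finset.mul_sum]
          ring
        simp only [h5, Finset.sum_sub_distrib, ← Finset.mul_sum (a := B)]
        linear_combination (-B) * h4
      rw [h1, hh x]
      refine (Finset.abs_sum_le_sum_abs _ _).trans (Finset.sum_le_sum fun y _ => ?_)
      rw [abs_mul, abs_mul, abs_of_nonneg (trans_nonneg M w x y),
        abs_of_nonneg (one_sub_beta_nonneg w y)]
      exact mul_le_mul_of_nonneg_left (mul_le_mul_of_nonneg_left (ih y)
        (one_sub_beta_nonneg w y)) (trans_nonneg M w x y)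
  have lim : Tendsto (fun n => B * (1 - ∑ l ∈ Finset.range n, lengthProb M w s l)) atTop
      (𝓝 (B * (1 - 1))) := ((hlen s).1.tendsto_sum_nat.const_sub 1).const_mul B
  have := ge_of_tendsto' lim fun n => key n s
  rw [sub_self, mul_zero] at this
  exact abs_nonpos_iff.1 this

/-- A solution of the one-step equation of an option with terminal values `f`, in terms of the
option's mean reward, mean length and termination probabilities. -/
theorem eq_option_model [DecidableEq S] (c : ℝ) (f h : S → ℝ)
    (hh : ∀ s, h s = stepReward M w s - c +
      ∑ x, trans M w s x * ((1 - w.beta x) * h x + w.beta x * f x)) (s : S) :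
    h s = meanOptionReward M w s - c * meanOptionLength M w s +
      ∑ s', termProb M w s s' * f s' := by
  have hF : ∀ s, ∑ s', termProb M w s s' * f s' = ∑ x, trans M w s x *
      ((1 - w.beta x) * (∑ s', termProb M w x s' * f s') + w.beta x * f x) := fun s => by
    have : ∀ s', termProb M w s s' * f s' = ∑ x, trans M w s x *
        ((1 - w.beta x) * (termProb M w x s' * f s') +
          w.beta x * if x = s' then f s' else 0) := fun s' => by
      rw [termProb_eq M w hlen, Finset.sum_mul]
      refine Finset.sum_congr rfl fun x _ => ?_
      split_ifs <;> ring
    simp only [this]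
    rw [Finset.sum_comm]
    refine Finset.sum_congr rfl fun x _ => ?_
    rw [← Finset.mul_sum, Finset.sum_add_distrib, ← Finset.mul_sum, ← Finset.mul_sum]
    simp
  -- Both sides solve the same inhomogeneous equation, so their difference is harmonic for the
  -- killed transitions.
  have key := eq_zero_of_killed_harmonic M w hlen (fun s => h s - (meanOptionReward M w s -
    c * meanOptionLength M w s + ∑ s', termProb M w s s' * f s')) (fun s => by
      rw [hF s, meanOptionReward_eq M w hlen s, meanOptionLength_eq M w hlen s, hh s]
      simp only [mul_add, mul_sub, Finset.sum_add_distrib, Finset.sum_sub_distrib, Finset.mul_sum]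
      simp only [mul_left_comm c]
      ring) s
  linarith

/-- A solution of the homogeneous one-step equation of an option with terminal values `f`. -/
theorem eq_termProb_sum [DecidableEq S] (f h : S → ℝ)
    (hh : ∀ s, h s = ∑ x, trans M w s x * ((1 - w.beta x) * h x + w.beta x * f x)) (s : S) :
    h s = ∑ s', termProb M w s s' * f s' := by
  -- Adding the mean reward turns the homogeneous equation into the one with rewards and `c = 0`.
  have := eq_option_model M w hlen 0 f (fun s => h s + meanOptionReward M w s) (fun s => by
    rw [hh s, meanOptionReward_eq M w hlen s]
    simp only [mul_add, Finset.sum_add_distrib]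
    ring) s
  linarith

end Execution

/-! ### Recurrent classes of a finite chain -/

section RecurrentClass

variable {S : Type*} [Fintype S] [DecidableEq S]

theorem matrix_pow_nonneg {K : Matrix S S ℝ} (hK : ∀ s s', 0 ≤ K s s') (n : ℕ) (s s' : S) :
    0 ≤ (K ^ n) s s' := by
  induction n generalizing s with
  | zero =>
    rw [pow_zero, Matrix.one_apply]
    split_ifs <;> simp
  | succ n ih =>
    rw [pow_succ', Matrix.mul_apply]
    exact Finset.sum_nonneg fun x _ => mul_nonneg (hK s x) (ih x)

/-- A nonempty closed set of states of a finite chain contains a recurrent class. -/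
theorem exists_recurrentClass_subset {K : Matrix S S ℝ} (hK : ∀ s s', 0 ≤ K s s') {D : Set S}
    (hne : D.Nonempty) (hD : ∀ s ∈ D, ∀ s' ∉ D, K s s' = 0) :
    ∃ C ⊆ D, IsRecurrentClass K C := by
  -- A minimal nonempty closed subset is the required class: the states reachable from any `s ∈ C`
  -- form a closed nonempty subset of `C`, hence all of `C`.
  obtain ⟨C, hCD, hC⟩ := (Set.toFinite
    {C : Set S | C.Nonempty ∧ ∀ s ∈ C, ∀ s' ∉ C, K s s' = 0}).exists_le_minimal ⟨hne, hD⟩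
  refine ⟨C, hCD, hC.prop.1, hC.prop.2, fun s hs s' hs' => ?_⟩
  have hsub : {x | ∃ n : ℕ, 0 < (K ^ n) s x} ⊆ C := by
    rintro x ⟨n, hn⟩
    induction n generalizing x with
    | zero =>
      rw [pow_zero, Matrix.one_apply] at hn
      split_ifs at hn with h
      · exact h ▸ hs
      · exact absurd hn (lt_irrefl _)
    | succ n ih =>
      rw [pow_succ, Matrix.mul_apply] at hn
      obtain ⟨y, -, hy⟩ := Finset.exists_lt_of_sum_lt (by simpa using hn :
        ∑ y : S, (0 : ℝ) < ∑ y, (K ^ n) s y * K y x)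
      have hpos : 0 < (K ^ n) s y ∧ 0 < K y x :=
        (pos_and_pos_or_neg_and_neg_of_mul_pos hy).resolve_right fun h => (hK y x).not_gt h.2
      by_contra hx
      exact hpos.2.ne' (hC.prop.2 y (ih hpos.1) x hx)
  refine hC.2 (y := {x | ∃ n : ℕ, 0 < (K ^ n) s x}) ⟨⟨s, 0, by simp⟩, ?_⟩ hsub hs'
  rintro x ⟨n, hn⟩ y hy
  by_contra hxy
  refine hy ⟨n + 1, ?_⟩
  rw [pow_succ, Matrix.mul_apply]
  exact Finset.sum_pos' (fun z _ => mul_nonneg (matrix_pow_nonneg hK n s z) (hK z y))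
    ⟨x, Finset.mem_univ x, mul_pos hn (lt_of_le_of_ne (hK x y) (Ne.symm hxy))⟩

omit [DecidableEq S] in
/-- The set where a subharmonic function attains its maximum is closed. -/
theorem closed_of_le_average {K : Matrix S S ℝ} (hK : ∀ s s', 0 ≤ K s s')
    (hsum : ∀ s, ∑ s', K s s' = 1) {g : S → ℝ} {m : ℝ} (hm : ∀ s, g s ≤ m) {s s' : S}
    (hs : g s = m) (hle : g s ≤ ∑ x, K s x * g x) (hs' : g s' ≠ m) : K s s' = 0 := by
  -- The nonnegative function `m - g` has nonpositive mean, so every term of that mean vanishes.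
  have h0 : ∑ x, K s x * (m - g x) ≤ 0 := by
    simp only [mul_sub, Finset.sum_sub_distrib, ← Finset.sum_mul, hsum]
    linarith
  have hnn : ∀ x ∈ Finset.univ, 0 ≤ K s x * (m - g x) := fun x _ =>
    mul_nonneg (hK s x) (sub_nonneg.2 (hm x))
  have h1 := (Finset.sum_eq_zero_iff_of_nonneg hnn).1 (le_antisymm h0 (Finset.sum_nonneg hnn))
    s' (Finset.mem_univ s')
  exact (mul_eq_zero.1 h1).resolve_right fun h => hs' (by linarith)

end RecurrentClass

/-! ### Poisson equation and ergodic averages of stochastic matrices -/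

section StochasticMatrix

variable {X : Type*} [Fintype X]

theorem abs_mulVec_le {P : Matrix X X ℝ} (hP : ∀ x y, 0 ≤ P x y) (hsum : ∀ x, ∑ y, P x y = 1)
    {v : X → ℝ} {B : ℝ} (hv : ∀ x, |v x| ≤ B) (x : X) : |P.mulVec v x| ≤ B := by
  calc |P.mulVec v x| ≤ ∑ y, |P x y * v y| := Finset.abs_sum_le_sum_abs _ _
    _ ≤ ∑ y, P x y * B := Finset.sum_le_sum fun y _ => by
        rw [abs_mul, abs_of_nonneg (hP x y)]
        exact mul_le_mul_of_nonneg_left (hv y) (hP x y)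
    _ = B := by rw [← Finset.sum_mul, hsum, one_mul]

theorem mulVec_mono {P : Matrix X X ℝ} (hP : ∀ x y, 0 ≤ P x y) {v w : X → ℝ}
    (h : ∀ x, v x ≤ w x) (x : X) : P.mulVec v x ≤ P.mulVec w x :=
  Finset.sum_le_sum fun y _ => mul_le_mul_of_nonneg_left (h y) (hP x y)

theorem mulVec_const_of_sum {P : Matrix X X ℝ} (hsum : ∀ x, ∑ y, P x y = 1) (c : ℝ) (x : X) :
    P.mulVec (fun _ => c) x = c := by
  simp only [Matrix.mulVec, dotProduct]
  rw [← Finset.sum_mul, hsum, one_mul]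

theorem exists_abs_le (v : X → ℝ) : ∃ B, 0 ≤ B ∧ ∀ x, |v x| ≤ B :=
  ⟨∑ x, |v x|, Finset.sum_nonneg fun _ _ => abs_nonneg _, fun x =>
    Finset.single_le_sum (f := fun x => |v x|) (fun _ _ => abs_nonneg _) (Finset.mem_univ x)⟩

variable [DecidableEq X]

theorem abs_pow_mulVec_le {P : Matrix X X ℝ} (hP : ∀ x y, 0 ≤ P x y)
    (hsum : ∀ x, ∑ y, P x y = 1) {v : X → ℝ} {B : ℝ} (hv : ∀ x, |v x| ≤ B) (n : ℕ) (x : X) :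
    |(P ^ n).mulVec v x| ≤ B := by
  induction n generalizing x with
  | zero => simpa using hv x
  | succ n ih =>
    rw [pow_succ', ← Matrix.mulVec_mulVec]
    exact abs_mulVec_le hP hsum ih x

theorem pow_sum_of_sum {P : Matrix X X ℝ} (hsum : ∀ x, ∑ y, P x y = 1) (n : ℕ) (x : X) :
    ∑ y, (P ^ n) x y = 1 := by
  induction n generalizing x with
  | zero => simp [Matrix.one_apply]
  | succ n ih =>
    simp only [pow_succ', Matrix.mul_apply]
    rw [Finset.sum_comm]
    simp only [← Finset.mul_sum, ih, mul_one, hsum]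

/-- For stochastic `P` the right side is bounded in `n`; every limit of averages below rests on
this. -/
theorem sum_pow_mulVec_sub (P : Matrix X X ℝ) (q : X → ℝ) (n : ℕ) (x : X) :
    ∑ i ∈ Finset.range n, (P ^ i).mulVec (q - P.mulVec q) x = q x - (P ^ n).mulVec q x := by
  have h : ∀ i, (P ^ i).mulVec (q - P.mulVec q) x =
      (P ^ i).mulVec q x - (P ^ (i + 1)).mulVec q x := fun i => by
    rw [Matrix.mulVec_sub, Matrix.mulVec_mulVec, ← pow_succ]
    rfl
  simp only [h]
  rw [Finset.sum_range_sub']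
  simp

theorem tendsto_bounded_div {b : ℕ → ℝ} {B : ℝ} (hb : ∀ n, |b n| ≤ B) :
    Tendsto (fun n : ℕ => b n / n) atTop (𝓝 0) := by
  refine squeeze_zero_norm (a := fun n : ℕ => B / n) (fun n => ?_)
    (tendsto_const_div_atTop_nhds_zero_nat B)
  rw [norm_div, Real.norm_eq_abs, RCLike.norm_natCast]
  exact div_le_div_of_nonneg_right (hb n) n.cast_nonneg

/-- The Poisson equation of a finite chain without nonconstant harmonic functions is solvable. -/
theorem exists_poisson [Nonempty X] {P : Matrix X X ℝ} (hP : ∀ x y, 0 ≤ P x y)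
    (hsum : ∀ x, ∑ y, P x y = 1)
    (hconst : ∀ h : X → ℝ, P.mulVec h = h → ∃ c, ∀ x, h x = c) (ρ : X → ℝ) :
    ∃ (c : ℝ) (q : X → ℝ), ∀ x, q x = ρ x - c + P.mulVec q x := by
  -- The unknown constant is an extra coordinate: `T (h, c) = h - P h + c`, from dimension `|X| + 1`
  -- to `|X|`. A kernel of dimension at most one therefore gives surjectivity.
  let T : (X → ℝ) × ℝ →ₗ[ℝ] (X → ℝ) :=
    (LinearMap.id - P.mulVecLin).coprod (LinearMap.toSpanSingleton ℝ _ fun _ => 1)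
  have hT : ∀ v, ∀ x, T v x = v.1 x - P.mulVec v.1 x + v.2 := fun v x => by simp [T]
  have hker : LinearMap.ker T ≤ Submodule.span ℝ {((fun _ => 1 : X → ℝ), (0 : ℝ))} := by
    rintro ⟨h, c⟩ hv
    have hx : ∀ x, h x - P.mulVec h x + c = 0 := fun x => by
      rw [← hT (h, c), LinearMap.mem_ker.1 hv]
      rfl
    have hc : c = 0 := by
      obtain ⟨B, -, hB⟩ := exists_abs_le h
      have hfun : h - P.mulVec h = fun _ => -c := funext fun x => by
        have := hx x
        simp only [Pi.sub_apply]
        linarith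
      obtain ⟨x⟩ := ‹Nonempty X›
      -- Telescoping `h - P h = -c` makes `n * -c` bounded in `n`, which forces `c = 0`.
      have h1 : ∀ n : ℕ, (n : ℝ) * -c = h x - (P ^ n).mulVec h x := fun n => by
        rw [← sum_pow_mulVec_sub, hfun]
        simp [mulVec_const_of_sum (pow_sum_of_sum hsum _)]
      have h2 : Tendsto (fun n : ℕ => (n : ℝ) * -c / n) atTop (𝓝 0) :=
        tendsto_bounded_div (B := B + B) fun n => by
          rw [h1]
          exact (abs_sub _ _).trans (add_le_add (hB x) (abs_pow_mulVec_le hP hsum hB n x))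
      have h3 : Tendsto (fun n : ℕ => (n : ℝ) * -c / n) atTop (𝓝 (-c)) :=
        tendsto_const_nhds.congr' ((eventually_gt_atTop 0).mono fun n hn => by
          have : (n : ℝ) ≠ 0 := by positivity
          field_simp)
      linarith [tendsto_nhds_unique h2 h3]
    subst hc
    obtain ⟨c, hc⟩ := hconst h (funext fun x => by linarith [hx x])
    refine Submodule.mem_span_singleton.2 ⟨c, ?_⟩
    ext x <;> simp [hc]
  have hsurj : Function.Surjective T := by
    rw [← LinearMap.range_eq_top]
    refine Submodule.eq_top_of_finrank_eq (le_antisymm (Submodule.finrank_le _) ?_)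
    have h1 := T.finrank_range_add_finrank_ker
    have h2 := (Submodule.finrank_mono hker).trans (finrank_span_le_card _)
    simp at h1 h2 ⊢
    omega
  obtain ⟨⟨q, c⟩, hq⟩ := hsurj ρ
  refine ⟨c, q, fun x => ?_⟩
  have := hT (q, c) x
  rw [hq] at this
  linarith

/-- Cesàro convergence in a finite chain without nonconstant harmonic functions. -/
theorem exists_tendsto_average [Nonempty X] {P : Matrix X X ℝ} (hP : ∀ x y, 0 ≤ P x y)
    (hsum : ∀ x, ∑ y, P x y = 1)
    (hconst : ∀ h : X → ℝ, P.mulVec h = h → ∃ c, ∀ x, h x = c) (v : X → ℝ) :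
    ∃ c : ℝ, ∀ x, Tendsto (fun N : ℕ => (∑ n ∈ Finset.Icc 1 N, (P ^ n).mulVec v x) / N) atTop
      (𝓝 c) := by
  obtain ⟨c, q, hq⟩ := exists_poisson hP hsum hconst v
  obtain ⟨B, -, hB⟩ := exists_abs_le q
  have hv : v = (q - P.mulVec q) + fun _ => c := funext fun x => by
    have := hq x
    simp only [Pi.add_apply, Pi.sub_apply]
    linarith
  -- The sum starts at `n = 1`, so the telescoped expression starts at `P q` instead of `q`.
  have hN : ∀ (N : ℕ) (x : X), ∑ n ∈ Finset.Icc 1 N, (P ^ n).mulVec v x =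
      P.mulVec q x - (P ^ (N + 1)).mulVec q x + N * c := fun N x => by
    have h1 := sum_pow_mulVec_sub P q (N + 1) x
    rw [Finset.sum_range_succ', pow_zero, Matrix.one_mulVec, Pi.sub_apply] at h1
    rw [← Finset.Ico_add_one_right_eq_Icc, Finset.sum_Ico_eq_sum_range, Nat.add_sub_cancel]
    simp only [add_comm 1]
    rw [hv]
    simp only [Matrix.mulVec_add, Pi.add_apply, Finset.sum_add_distrib,
      mulVec_const_of_sum (pow_sum_of_sum hsum _), Finset.sum_const, Finset.card_range,
      nsmul_eq_mul]
    linarith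
  refine ⟨c, fun x => ?_⟩
  have h0 : Tendsto (fun N : ℕ => (P.mulVec q x - (P ^ (N + 1)).mulVec q x) / N) atTop (𝓝 0) :=
    tendsto_bounded_div (B := B + B) fun n => (abs_sub _ _).trans
      (add_le_add (abs_mulVec_le hP hsum hB x) (abs_pow_mulVec_le hP hsum hB _ x))
  have h1 := h0.add_const c
  rw [zero_add] at h1
  refine h1.congr' ((eventually_gt_atTop 0).mono fun N hpos => ?_)
  have : (N : ℝ) ≠ 0 := by positivity
  simp only [hN]
  field_simp

end StochasticMatrix

/-! ### Option-level and step-level chains under a policy -/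

section Dynamics

variable {S A O : Type*} [Fintype S] [Fintype A] [Fintype O]

omit [Fintype O] in
theorem intraOptionEq_iff (M : FiniteMDP S A) (opt : O → TemporalOption S A)
    (u : S → O → ℝ) (c : ℝ) (q : S → O → ℝ) :
    IntraOptionEq M opt u c q ↔ ∀ s o, q s o =
      stepReward M (opt o) s - c + ∑ s', trans M (opt o) s s' * u s' o := by
  have h : ∀ s o, ∑ a, (opt o).pi s a * ∑ s', ∑ r : M.rewards,
      M.p s a s' r * ((r : ℝ) - c + u s' o) =
      stepReward M (opt o) s - c + ∑ s', trans M (opt o) s s' * u s' o := fun s o => by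
    have h1 : ∀ a, ∑ s', ∑ r : M.rewards, M.p s a s' r * ((r : ℝ) - c + u s' o) =
        ∑ s', ∑ r : M.rewards, M.p s a s' r * (r : ℝ) - c +
          ∑ s', (∑ r : M.rewards, M.p s a s' r) * u s' o := fun a => by
      simp only [mul_add, mul_sub, Finset.sum_add_distrib, Finset.sum_sub_distrib,
        ← Finset.sum_mul, M.p_sum, one_mul]
    rw [Finset.sum_congr rfl fun a _ => congrArg ((opt o).pi s a * ·) (h1 a)]
    simp only [mul_add, mul_sub, Finset.sum_add_distrib, Finset.sum_sub_distrib]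
    rw [← Finset.sum_mul, (opt o).pi_sum, one_mul]
    refine congrArg₂ (· + ·) rfl ?_
    simp only [trans, Finset.mul_sum, Finset.sum_mul, mul_assoc]
    rw [Finset.sum_comm]
  simp only [IntraOptionEq, h]

omit [Fintype S] in
theorem sum_policy_le (μ : Policy S O) (s : S) {f : O → ℝ} {m : ℝ} (hf : ∀ o, f o ≤ m) :
    ∑ o, μ.prob s o * f o ≤ m := by
  calc ∑ o, μ.prob s o * f o ≤ ∑ o, μ.prob s o * m :=
        Finset.sum_le_sum fun o _ => mul_le_mul_of_nonneg_left (hf o) (μ.prob_nonneg s o)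
    _ = m := by rw [← Finset.sum_mul, μ.prob_sum, one_mul]

/-- The policy that chooses the option `δ s` in the state `s`. -/
def Policy.deterministic [DecidableEq O] (δ : S → O) : Policy S O where
  prob s o := if o = δ s then 1 else 0
  prob_nonneg s o := by split_ifs <;> simp
  prob_sum s := by simp

section Induced

variable [DecidableEq S] (M : FiniteMDP S A) (opt : O → TemporalOption S A)

theorem inducedChain_nonneg (μ : Policy S O) (s s' : S) : 0 ≤ inducedChain M opt μ s s' :=
  Finset.sum_nonneg fun o _ => mul_nonneg (μ.prob_nonneg s o) (termProb_nonneg M (opt o) s s')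

theorem inducedChain_average (μ : Policy S O) (g : S → ℝ) (s : S) :
    ∑ s', inducedChain M opt μ s s' * g s' =
      ∑ o, μ.prob s o * ∑ s', termProb M (opt o) s s' * g s' := by
  simp only [inducedChain, Finset.sum_mul, Finset.mul_sum, mul_assoc]
  rw [Finset.sum_comm]

variable (hlen : ∀ s o, FiniteMeanLength M (opt o) s)
include hlen

theorem inducedChain_sum (μ : Policy S O) (s : S) : ∑ s', inducedChain M opt μ s s' = 1 := by
  have h := inducedChain_average M opt μ (fun _ => 1) s
  simp only [mul_one] at h
  simp only [h, fun o => termProb_sum M (opt o) (fun s => hlen s o) s, mul_one, μ.prob_sum]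

/-- Under the unichain condition, a function that is subharmonic for one policy and superharmonic
for another is constant: otherwise, following the first policy where the function is maximal and
the second one where it is minimal gives two recurrent classes. -/
theorem exists_const_of_sub_super [Nonempty S]
    (huni : ∀ μ : Policy S O, IsUnichain (inducedChain M opt μ)) (μ₁ μ₂ : Policy S O) (g : S → ℝ)
    (h₁ : ∀ s, g s ≤ ∑ s', inducedChain M opt μ₁ s s' * g s')
    (h₂ : ∀ s, ∑ s', inducedChain M opt μ₂ s s' * g s' ≤ g s) : ∃ c, ∀ s, g s = c := by
  classical
  obtain ⟨x, hx⟩ := Finite.exists_max g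
  obtain ⟨y, hy⟩ := Finite.exists_min g
  by_cases hxy : g x = g y
  · exact ⟨g x, fun s => le_antisymm (hx s) (hxy ▸ hy s)⟩
  -- This policy makes the maximum set of `g` closed through `μ₁` and the minimum set closed through
  -- `μ₂`. The sets are disjoint, so the two recurrent classes inside them differ.
  let μ : Policy S O :=
    { prob := fun s o => if g s = g x then μ₁.prob s o else μ₂.prob s o
      prob_nonneg := fun s o => by
        split_ifs
        exacts [μ₁.prob_nonneg s o, μ₂.prob_nonneg s o]
      prob_sum := fun s => by
        split_ifs
        exacts [μ₁.prob_sum s, μ₂.prob_sum s] }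
  have e₁ : ∀ s s', g s = g x → inducedChain M opt μ s s' = inducedChain M opt μ₁ s s' :=
    fun s s' h => by simp only [inducedChain, μ, if_pos h]
  have e₂ : ∀ s s', g s = g y → inducedChain M opt μ s s' = inducedChain M opt μ₂ s s' :=
    fun s s' h => by
      have h' : ¬ g s = g x := fun h' => hxy (h'.symm.trans h)
      simp only [inducedChain, μ, if_neg h']
  have c₁ : ∀ s ∈ {s | g s = g x}, ∀ s' ∉ {s | g s = g x}, inducedChain M opt μ s s' = 0 :=
    fun s hs s' hs' => by
      rw [e₁ s s' hs]
      exact closed_of_le_average (inducedChain_nonneg M opt μ₁) (inducedChain_sum M opt hlen μ₁)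
        hx hs (h₁ s) hs'
  have c₂ : ∀ s ∈ {s | g s = g y}, ∀ s' ∉ {s | g s = g y}, inducedChain M opt μ s s' = 0 :=
    fun s hs s' hs' => by
      rw [e₂ s s' hs]
      -- The minimum of `g` is treated as the maximum of `-g`.
      refine closed_of_le_average (inducedChain_nonneg M opt μ₂) (inducedChain_sum M opt hlen μ₂)
        (g := fun s => -g s) (m := -g y) (fun s => neg_le_neg (hy s)) (congrArg Neg.neg hs) ?_
        fun h => hs' (neg_injective h)
      simpa using h₂ s
  obtain ⟨C₁, hC₁, r₁⟩ := exists_recurrentClass_subset (D := {s | g s = g x})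
    (inducedChain_nonneg M opt μ) ⟨x, rfl⟩ c₁
  obtain ⟨C₂, hC₂, r₂⟩ := exists_recurrentClass_subset (D := {s | g s = g y})
    (inducedChain_nonneg M opt μ) ⟨y, rfl⟩ c₂
  obtain ⟨z, hz⟩ := r₁.1
  have hz₁ : g z = g x := hC₁ hz
  have hz₂ : g z = g y := hC₂ ((huni μ).unique r₁ r₂ ▸ hz)
  exact absurd (hz₁.symm.trans hz₂) hxy

end Induced

/-! ### Evaluation equation, reward rate and differential values -/

section Step

variable [DecidableEq O] (M : FiniteMDP S A) (opt : O → TemporalOption S A) (μ : Policy S O)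

/-- Transition matrix of (state, executing option) from one time step to the next. -/
def intraStep : Matrix (S × O) (S × O) ℝ := fun x y =>
  trans M (opt x.2) x.1 y.1 * ((opt x.2).beta y.1 * μ.prob y.1 y.2 +
    (1 - (opt x.2).beta y.1) * if y.2 = x.2 then 1 else 0)

omit [Fintype S] in
theorem sum_switch (g : O → ℝ) (s : S) (o : O) :
    ∑ o', ((opt o).beta s * μ.prob s o' + (1 - (opt o).beta s) * if o' = o then 1 else 0) * g o' =
      (1 - (opt o).beta s) * g o + (opt o).beta s * ∑ o', μ.prob s o' * g o' := by
  simp only [add_mul, Finset.sum_add_distrib, mul_assoc, ← Finset.mul_sum]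
  simp [add_comm]

theorem intraStep_mulVec (g : S × O → ℝ) (s : S) (o : O) :
    (intraStep M opt μ).mulVec g (s, o) =
      ∑ s', trans M (opt o) s s' * uEval opt μ (fun s o => g (s, o)) s' o := by
  simp only [Matrix.mulVec, dotProduct, intraStep, Fintype.sum_prod_type, mul_assoc,
    ← Finset.mul_sum]
  refine Finset.sum_congr rfl fun s' _ => ?_
  exact congrArg _ (sum_switch opt μ (fun o' => g (s', o')) s' o)

theorem intraStep_nonneg (x y : S × O) : 0 ≤ intraStep M opt μ x y := by
  refine mul_nonneg (trans_nonneg M _ _ _) (add_nonneg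
    (mul_nonneg ((opt x.2).beta_nonneg _) (μ.prob_nonneg _ _))
    (mul_nonneg (one_sub_beta_nonneg _ _) ?_))
  split_ifs <;> simp

theorem intraStep_sum (x : S × O) : ∑ y, intraStep M opt μ x y = 1 := by
  have h := intraStep_mulVec M opt μ (fun _ => 1) x.1 x.2
  simp only [uEval, mul_one, μ.prob_sum, sub_add_cancel, trans_sum] at h
  simpa [Matrix.mulVec, dotProduct] using h

/-- In this form the equation is the Poisson equation of `intraStep`. -/
theorem evaluationEq_iff (c : ℝ) (q : S → O → ℝ) :
    EvaluationEq M opt μ c q ↔ ∀ x : S × O, q x.1 x.2 = stepReward M (opt x.2) x.1 - c +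
      (intraStep M opt μ).mulVec (fun x => q x.1 x.2) x := by
  rw [EvaluationEq, intraOptionEq_iff, Prod.forall]
  simp only [intraStep_mulVec]

theorem sum_stepProb_mul (g : S × O → ℝ) (s : S) (o : O) :
    ∑ z : A × S × M.rewards × O, stepProb M opt μ s o z * g (z.2.1, z.2.2.2) =
      (intraStep M opt μ).mulVec g (s, o) := by
  rw [intraStep_mulVec, ← sum_step_mul]
  simp only [Fintype.sum_prod_type, stepProb, mul_assoc, ← Finset.mul_sum]
  refine Finset.sum_congr rfl fun a _ => ?_
  refine congrArg _ (Finset.sum_congr rfl fun s' _ => Finset.sum_congr rfl fun r _ => ?_)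
  exact congrArg _ (sum_switch opt μ (fun o' => g (s', o')) s' o)

theorem sum_stepProb_reward (s : S) (o : O) :
    ∑ z : A × S × M.rewards × O, stepProb M opt μ s o z * (z.2.2.1 : ℝ) =
      stepReward M (opt o) s := by
  rw [← sum_step_reward]
  simp only [Fintype.sum_prod_type, stepProb, mul_assoc, ← Finset.mul_sum]
  refine Finset.sum_congr rfl fun a _ => ?_
  refine congrArg _ (Finset.sum_congr rfl fun s' _ => Finset.sum_congr rfl fun r _ => ?_)
  have h := sum_switch opt μ (fun _ => (r : ℝ)) s' o
  rw [← Finset.sum_mul (s := Finset.univ) (f := fun o' => μ.prob s' o'), μ.prob_sum] at h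
  rw [h]
  ring

theorem sum_stepProb (s : S) (o : O) :
    ∑ z : A × S × M.rewards × O, stepProb M opt μ s o z = 1 := by
  have h := sum_stepProb_mul M opt μ (fun _ => 1) s o
  rw [mulVec_const_of_sum (intraStep_sum M opt μ)] at h
  simpa using h

theorem sum_trajProb (n : ℕ) (s : S) (o : O) : ∑ τ, trajProb M opt μ n s o τ = 1 := by
  induction n generalizing s o with
  | zero => simp [trajProb]
  | succ n ih =>
    rw [sum_fin_succ_fun]
    simp only [trajProb, Fin.cons_zero, Fin.tail_cons, ← Finset.mul_sum, ih, mul_one]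
    exact sum_stepProb M opt μ s o

theorem expectedReturn_succ (c : ℝ) (s : S) (o : O) (n : ℕ) :
    expectedReturn M opt μ c s o (n + 1) = stepReward M (opt o) s - c +
      (intraStep M opt μ).mulVec (fun x => expectedReturn M opt μ c x.1 x.2 n) (s, o) := by
  rw [← sum_stepProb_mul, expectedReturn, sum_fin_succ_fun]
  have h : ∀ z : A × S × M.rewards × O, ∑ τ : Fin n → A × S × M.rewards × O,
      trajProb M opt μ (n + 1) s o (Fin.cons z τ) *
        ∑ i, ((((Fin.cons z τ : Fin (n + 1) → A × S × M.rewards × O) i).2.2.1 : ℝ) - c) =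
      stepProb M opt μ s o z * (z.2.2.1 : ℝ) - c * stepProb M opt μ s o z +
        stepProb M opt μ s o z * expectedReturn M opt μ c z.2.1 z.2.2.2 n := fun z => by
    simp only [trajProb, Fin.sum_univ_succ, Fin.cons_zero, Fin.cons_succ, Fin.tail_cons, mul_add,
      Finset.sum_add_distrib, mul_assoc, ← Finset.mul_sum, ← Finset.sum_mul, sum_trajProb,
      expectedReturn]
    ring
  rw [Finset.sum_congr rfl fun z _ => h z]
  simp only [Finset.sum_add_distrib, Finset.sum_sub_distrib, ← Finset.mul_sum,
    sum_stepProb_reward, sum_stepProb, mul_one]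

variable [DecidableEq S]

/-- The expected return in terms of a solution of the evaluation equation. -/
theorem expectedReturn_eq {c : ℝ} {q : S → O → ℝ} (hq : EvaluationEq M opt μ c q) (b : ℝ)
    (n : ℕ) (s : S) (o : O) :
    expectedReturn M opt μ b s o n = n * (c - b) +
      (q s o - (intraStep M opt μ ^ n).mulVec (fun x => q x.1 x.2) (s, o)) := by
  induction n generalizing s o with
  | zero => simp [expectedReturn]
  | succ n ih =>
    rw [expectedReturn_succ]
    have hfun : (fun x : S × O => expectedReturn M opt μ b x.1 x.2 n) =
        (fun _ => n * (c - b)) + ((fun x => q x.1 x.2) -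
          (intraStep M opt μ ^ n).mulVec fun x => q x.1 x.2) := funext fun x => ih x.1 x.2
    rw [hfun, Matrix.mulVec_add, Matrix.mulVec_sub, Matrix.mulVec_mulVec, ← pow_succ',
      Pi.add_apply, Pi.sub_apply, mulVec_const_of_sum (intraStep_sum M opt μ)]
    have := (evaluationEq_iff M opt μ c q).1 hq (s, o)
    simp only at this
    push_cast
    linarith

/-- With `b = 0` in `expectedReturn_eq`, the return after `n` steps is `n * c` plus a bounded term.
-/
theorem tendsto_expectedReturn_div {c : ℝ} {q : S → O → ℝ} (hq : EvaluationEq M opt μ c q)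
    (s : S) (o : O) :
    Tendsto (fun t : ℕ => expectedReturn M opt μ 0 s o t / t) atTop (𝓝 c) := by
  obtain ⟨B, -, hB⟩ := exists_abs_le fun x : S × O => q x.1 x.2
  have h := (tendsto_bounded_div (B := B + B)
    (b := fun n => q s o - (intraStep M opt μ ^ n).mulVec (fun x => q x.1 x.2) (s, o))
    fun n => (abs_sub _ _).trans (add_le_add (hB (s, o)) (abs_pow_mulVec_le
      (intraStep_nonneg M opt μ) (intraStep_sum M opt μ) hB n (s, o)))).const_add c
  rw [add_zero] at h
  refine h.congr' ((eventually_gt_atTop 0).mono fun N hpos => ?_)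
  have : (N : ℝ) ≠ 0 := by positivity
  simp only [expectedReturn_eq M opt μ hq]
  field_simp
  ring

omit [DecidableEq O] in
theorem decisionChain_mulVec (g : S × O → ℝ) (s : S) (o : O) :
    (decisionChain M opt μ).mulVec g (s, o) =
      ∑ s', termProb M (opt o) s s' * ∑ o', μ.prob s' o' * g (s', o') := by
  simp only [Matrix.mulVec, dotProduct, decisionChain, Fintype.sum_prod_type, mul_assoc,
    ← Finset.mul_sum]

omit [DecidableEq O] in
theorem decisionChain_nonneg (x y : S × O) : 0 ≤ decisionChain M opt μ x y :=
  mul_nonneg (termProb_nonneg M _ _ _) (μ.prob_nonneg _ _)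

variable (hlen : ∀ s o, FiniteMeanLength M (opt o) s)
include hlen

omit [DecidableEq O] in
theorem decisionChain_sum (x : S × O) : ∑ y, decisionChain M opt μ x y = 1 := by
  have h := decisionChain_mulVec M opt μ (fun _ => 1) x.1 x.2
  simp only [mul_one, μ.prob_sum, termProb_sum M (opt x.2) (fun s => hlen s x.2)] at h
  simpa [Matrix.mulVec, dotProduct] using h

/-- The numerator is `c` times the denominator plus a bounded telescoped term, while the denominator
grows at least linearly because every option lasts at least one step. -/
theorem tendsto_optionRatio {c : ℝ} {q : S → O → ℝ} (hq : EvaluationEq M opt μ c q)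
    (s : S) (o : O) : Tendsto (optionRatio M opt μ s o) atTop (𝓝 c) := by
  set D := decisionChain M opt μ with hD
  have hD0 : ∀ x y, 0 ≤ D x y := decisionChain_nonneg M opt μ
  have hD1 : ∀ x, ∑ y, D x y = 1 := decisionChain_sum M opt μ hlen
  let R : S × O → ℝ := fun y => meanOptionReward M (opt y.2) y.1
  let T : S × O → ℝ := fun y => meanOptionLength M (opt y.2) y.1
  let Q : S × O → ℝ := fun y => q y.1 y.2
  -- This is the evaluation equation at the option level, with the `μ`-average of `q` as terminal
  -- value.
  have hR : R = (Q - D.mulVec Q) + c • T := funext fun x => by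
    have h := eq_option_model M (opt x.2) (fun s => hlen s x.2) c
      (fun s' => ∑ o', μ.prob s' o' * q s' o') (fun s => q s x.2)
      (fun s => (intraOptionEq_iff M opt _ c q).1 hq s x.2) x.1
    have h' := decisionChain_mulVec M opt μ Q x.1 x.2
    simp only [Pi.add_apply, Pi.sub_apply, Pi.smul_apply, smul_eq_mul, hD]
    simp only [Q, R, T] at h' ⊢
    rw [h']
    linarith
  obtain ⟨B, hB0, hB⟩ := exists_abs_le Q
  let den : ℕ → ℝ := fun n => ∑ i ∈ Finset.range n, (D ^ i).mulVec T (s, o)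
  have hden : ∀ n : ℕ, (n : ℝ) ≤ den n := fun n => by
    have : ∀ i ∈ Finset.range n, 1 ≤ (D ^ i).mulVec T (s, o) := fun i _ => by
      rw [← mulVec_const_of_sum (pow_sum_of_sum hD1 i) 1 (s, o)]
      exact mulVec_mono (matrix_pow_nonneg hD0 i)
        (fun x => one_le_meanOptionLength M (opt x.2) (fun s => hlen s x.2) x.1) _
    simpa using Finset.card_nsmul_le_sum _ _ _ this
  have hratio : ∀ n, optionRatio M opt μ s o n =
      c + (Q (s, o) - (D ^ (n + 1)).mulVec Q (s, o)) / den (n + 1) := fun n => by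
    have hpos : den (n + 1) ≠ 0 := by
      have := hden (n + 1)
      push_cast at this
      have : (0 : ℝ) ≤ n := n.cast_nonneg
      linarith
    have : optionRatio M opt μ s o n =
        (∑ i ∈ Finset.range (n + 1), (D ^ i).mulVec R (s, o)) / den (n + 1) := rfl
    rw [this, hR]
    simp only [Matrix.mulVec_add, Matrix.mulVec_smul, Pi.add_apply, Pi.smul_apply,
      Finset.sum_add_distrib, smul_eq_mul, ← Finset.mul_sum, sum_pow_mulVec_sub]
    change (_ + c * den (n + 1)) / den (n + 1) = _
    field_simp
    ring
  have h0 : Tendsto (fun n => (Q (s, o) - (D ^ (n + 1)).mulVec Q (s, o)) / den (n + 1)) atTop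
      (𝓝 0) := by
    refine squeeze_zero_norm (a := fun n : ℕ => (B + B) / ((n + 1 : ℕ) : ℝ)) (fun n => ?_)
      ((tendsto_const_div_atTop_nhds_zero_nat (B + B)).comp (tendsto_add_atTop_nat 1))
    have hp : (0 : ℝ) < ((n + 1 : ℕ) : ℝ) := by positivity
    rw [norm_div, Real.norm_eq_abs, Real.norm_eq_abs,
      abs_of_pos (hp.trans_le (hden (n + 1)))]
    exact div_le_div₀ (by positivity) ((abs_sub _ _).trans (add_le_add (hB _)
      (abs_pow_mulVec_le hD0 hD1 hB _ _))) hp (hden (n + 1))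
  have h1 := h0.const_add c
  rw [add_zero] at h1
  exact h1.congr fun n => (hratio n).symm

variable [Nonempty S] (huni : ∀ μ : Policy S O, IsUnichain (inducedChain M opt μ))
include huni

/-- A harmonic `h` is the mean, over the termination state, of its `μ`-averages. These averages are
harmonic for the induced chain, hence constant, and so is `h`. -/
theorem intraStep_harmonic_const (h : S × O → ℝ) (hh : (intraStep M opt μ).mulVec h = h) :
    ∃ c, ∀ x, h x = c := by
  have h1 : ∀ s o, h (s, o) =
      ∑ s', termProb M (opt o) s s' * ∑ o', μ.prob s' o' * h (s', o') := fun s o =>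
    eq_termProb_sum M (opt o) (fun s => hlen s o) _ (fun s => h (s, o)) (fun s => by
      simpa [uEval] using
        ((congrFun hh (s, o)).symm.trans (intraStep_mulVec M opt μ h s o))) s
  have h2 : ∀ s, ∑ s', inducedChain M opt μ s s' * (∑ o', μ.prob s' o' * h (s', o')) =
      ∑ o, μ.prob s o * h (s, o) := fun s => by
    rw [inducedChain_average]
    simp only [← h1]
  obtain ⟨c, hc⟩ := exists_const_of_sub_super M opt hlen huni μ μ
    (fun s => ∑ o, μ.prob s o * h (s, o)) (fun s => (h2 s).ge) (fun s => (h2 s).le)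
  refine ⟨c, fun x => ?_⟩
  have := h1 x.1 x.2
  simp only [hc, ← Finset.sum_mul, termProb_sum M (opt x.2) (fun s => hlen s x.2), one_mul] at this
  exact this

variable [Nonempty O]

theorem exists_evaluationEq : ∃ (c : ℝ) (q : S → O → ℝ), EvaluationEq M opt μ c q := by
  obtain ⟨c, q, hq⟩ := exists_poisson (intraStep_nonneg M opt μ) (intraStep_sum M opt μ)
    (intraStep_harmonic_const M opt μ hlen huni) fun x => stepReward M (opt x.2) x.1
  exact ⟨c, fun s o => q (s, o), (evaluationEq_iff M opt μ c _).2 hq⟩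

omit huni in
theorem rewardRate_eq {c : ℝ} {q : S → O → ℝ} (hq : EvaluationEq M opt μ c q) :
    rewardRate M opt μ = c :=
  (tendsto_optionRatio M opt μ hlen hq _ _).limUnder_eq

/-- At the true rate the return is `q - P ^ n q`. In a periodic chain `P ^ n q` need not converge,
but its averages tend to a constant independent of the start. -/
theorem exists_tendsto_cesaroReturn {c : ℝ} {q : S → O → ℝ} (hq : EvaluationEq M opt μ c q) :
    ∃ b, ∀ s o, Tendsto (cesaroReturn M opt μ s o) atTop (𝓝 (q s o - b)) := by
  obtain ⟨b, hb⟩ := exists_tendsto_average (intraStep_nonneg M opt μ) (intraStep_sum M opt μ)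
    (intraStep_harmonic_const M opt μ hlen huni) fun x => q x.1 x.2
  refine ⟨b, fun s o => ((hb (s, o)).const_sub (q s o)).congr'
    ((eventually_gt_atTop 0).mono fun N hpos => ?_)⟩
  have : (N : ℝ) ≠ 0 := by positivity
  simp only [cesaroReturn, rewardRate_eq M opt μ hlen hq, expectedReturn_eq M opt μ hq, sub_self,
    mul_zero, zero_add, Finset.sum_sub_distrib, Finset.sum_const, Nat.card_Icc,
    Nat.add_sub_cancel, nsmul_eq_mul]
  field_simp

theorem exists_diffValue_eq {c : ℝ} {q : S → O → ℝ} (hq : EvaluationEq M opt μ c q) :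
    ∃ b, ∀ s o, diffValue M opt μ s o = q s o - b := by
  obtain ⟨b, hb⟩ := exists_tendsto_cesaroReturn M opt μ hlen huni hq
  exact ⟨b, fun s o => (hb s o).limUnder_eq⟩

end Step

end Dynamics

/-! ### The optimality equation -/

section Optimality

variable {S A O : Type*} [Fintype S] [Fintype A] [Fintype O] [Nonempty O]

/-- The value of the best option in the state `s`. -/
def maxValue (q : S → O → ℝ) (s : S) : ℝ :=
  Finset.univ.sup' Finset.univ_nonempty fun o => q s o

omit [Fintype S] in
theorem le_maxValue (q : S → O → ℝ) (s : S) (o : O) : q s o ≤ maxValue q s :=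
  Finset.le_sup' (fun o => q s o) (Finset.mem_univ o)

omit [Fintype S] in
theorem maxValue_le {q : S → O → ℝ} {s : S} {m : ℝ} (h : ∀ o, q s o ≤ m) : maxValue q s ≤ m :=
  Finset.sup'_le _ _ fun o _ => h o

omit [Fintype S] in
theorem exists_greedy (q : S → O → ℝ) : ∃ δ : S → O, ∀ s, q s (δ s) = maxValue q s := by
  have h : ∀ s, ∃ o, q s o = maxValue q s := fun s => by
    obtain ⟨o, -, ho⟩ := Finset.exists_mem_eq_sup' Finset.univ_nonempty fun o => q s o
    exact ⟨o, ho.symm⟩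
  exact ⟨fun s => (h s).choose, fun s => (h s).choose_spec⟩

omit [Fintype S] in
theorem maxValue_add_const (q : S → O → ℝ) (c : ℝ) (s : S) :
    maxValue (fun s o => q s o + c) s = maxValue q s + c := by
  refine le_antisymm (maxValue_le fun o => add_le_add_left (le_maxValue q s o) c) ?_
  obtain ⟨δ, hδ⟩ := exists_greedy q
  rw [← hδ]
  exact le_maxValue (fun s o => q s o + c) s (δ s)

theorem maxValue_sub_le (q q' : S → O → ℝ) (s : S) :
    maxValue q s - maxValue q' s ≤ dist q q' := by
  rw [sub_le_iff_le_add]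
  refine maxValue_le fun o => ?_
  have h1 : q s o - q' s o ≤ dist q q' :=
    (le_abs_self _).trans (((dist_le_pi_dist (q s) (q' s) o)).trans (dist_le_pi_dist q q' s))
  linarith [le_maxValue q' s o]

omit [Fintype S] in
theorem isGreedy_average {μ : Policy S O} {q : S → O → ℝ} (h : IsGreedy μ q) (s : S) :
    ∑ o, μ.prob s o * q s o = maxValue q s := by
  have h1 : ∀ o, μ.prob s o * q s o = μ.prob s o * maxValue q s := fun o => by
    rcases (μ.prob_nonneg s o).eq_or_lt with h0 | h0
    · rw [← h0, zero_mul, zero_mul]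
    · rw [le_antisymm (le_maxValue q s o) (maxValue_le (h s o h0))]
  simp only [h1, ← Finset.sum_mul, μ.prob_sum, one_mul]

omit [Fintype S] in
theorem isGreedy_deterministic [DecidableEq O] {δ : S → O} {q : S → O → ℝ}
    (h : ∀ s, q s (δ s) = maxValue q s) : IsGreedy (Policy.deterministic δ) q := by
  intro s o ho o'
  have : o = δ s := by
    by_contra hne
    simp [Policy.deterministic, hne] at ho
  rw [this, h]
  exact le_maxValue q s o'

variable (M : FiniteMDP S A) (opt : O → TemporalOption S A)

omit [Fintype S] in
theorem uOpt_eq (q : S → O → ℝ) (s : S) (o : O) :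
    uOpt opt q s o = (1 - (opt o).beta s) * q s o + (opt o).beta s * maxValue q s := rfl

omit [Fintype S] in
theorem uOpt_add_const (q : S → O → ℝ) (c : ℝ) (s : S) (o : O) :
    uOpt opt (fun s o => q s o + c) s o = uOpt opt q s o + c := by
  rw [uOpt_eq, uOpt_eq, maxValue_add_const]
  ring

omit [Fintype S] in
theorem uEval_eq_uOpt_of_isGreedy {μ : Policy S O} {q : S → O → ℝ} (h : IsGreedy μ q) :
    uEval opt μ q = uOpt opt q := by
  funext s o
  rw [uEval, uOpt_eq, isGreedy_average h]

omit [Fintype S] in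
theorem uEval_le_uOpt (μ : Policy S O) (q : S → O → ℝ) (s : S) (o : O) :
    uEval opt μ q s o ≤ uOpt opt q s o := by
  rw [uEval, uOpt_eq]
  exact add_le_add_right (mul_le_mul_of_nonneg_left
    (sum_policy_le μ s fun o => le_maxValue q s o) ((opt o).beta_nonneg s)) _

theorem OptimalityEq.evaluationEq {μ : Policy S O} {c : ℝ} {q : S → O → ℝ}
    (hq : OptimalityEq M opt c q) (h : IsGreedy μ q) : EvaluationEq M opt μ c q := by
  rw [EvaluationEq, uEval_eq_uOpt_of_isGreedy opt h]
  exact hq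

theorem OptimalityEq.add_const {c : ℝ} {q : S → O → ℝ} (hq : OptimalityEq M opt c q) (b : ℝ) :
    OptimalityEq M opt c fun s o => q s o + b := by
  rw [OptimalityEq, intraOptionEq_iff] at hq ⊢
  intro s o
  rw [hq s o]
  simp only [uOpt_add_const, mul_add, Finset.sum_add_distrib, ← Finset.sum_mul, trans_sum]
  ring

/-- A convex combination of two maps that are nonexpansive in the sup norm. It gives both the
discounted contraction and the continuity needed in the vanishing-discount limit. -/
theorem dist_uOpt_le (q q' : S → O → ℝ) (s : S) (o : O) :
    |uOpt opt q s o - uOpt opt q' s o| ≤ dist q q' := by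
  have h1 : |q s o - q' s o| ≤ dist q q' :=
    (dist_le_pi_dist (q s) (q' s) o).trans (dist_le_pi_dist q q' s)
  have h2 : |maxValue q s - maxValue q' s| ≤ dist q q' :=
    abs_sub_le_iff.2 ⟨maxValue_sub_le q q' s, dist_comm q q' ▸ maxValue_sub_le q' q s⟩
  have h3 := (opt o).beta_nonneg s
  have h4 := one_sub_beta_nonneg (opt o) s
  rw [uOpt_eq, uOpt_eq]
  calc _ = |(1 - (opt o).beta s) * (q s o - q' s o) +
        (opt o).beta s * (maxValue q s - maxValue q' s)| := by congr 1; ring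
    _ ≤ (1 - (opt o).beta s) * |q s o - q' s o| +
        (opt o).beta s * |maxValue q s - maxValue q' s| := by
      refine (abs_add_le _ _).trans (le_of_eq ?_)
      rw [abs_mul, abs_mul, abs_of_nonneg h3, abs_of_nonneg h4]
    _ ≤ (1 - (opt o).beta s) * dist q q' + (opt o).beta s * dist q q' :=
      add_le_add (mul_le_mul_of_nonneg_left h1 h4) (mul_le_mul_of_nonneg_left h2 h3)
    _ = dist q q' := by ring

/-- The discounted intra-option optimality equation has a solution. -/
theorem exists_discounted {γ : ℝ} (h0 : 0 ≤ γ) (h1 : γ < 1) :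
    ∃ q : S → O → ℝ, ∀ s o, q s o = stepReward M (opt o) s +
      γ * ∑ s', trans M (opt o) s s' * uOpt opt q s' o := by
  let T : (S → O → ℝ) → S → O → ℝ := fun q s o => stepReward M (opt o) s +
    γ * ∑ s', trans M (opt o) s s' * uOpt opt q s' o
  have hT : ContractingWith ⟨γ, h0⟩ T := by
    refine ⟨h1, LipschitzWith.of_dist_le_mul fun q q' => ?_⟩
    have hnn : 0 ≤ γ * dist q q' := mul_nonneg h0 dist_nonneg
    refine (dist_pi_le_iff hnn).2 fun s => (dist_pi_le_iff hnn).2 fun o => ?_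
    have e : T q s o - T q' s o =
        γ * ∑ s', trans M (opt o) s s' * (uOpt opt q s' o - uOpt opt q' s' o) := by
      simp only [T, mul_sub, Finset.sum_sub_distrib]
      ring
    rw [Real.dist_eq, e, abs_mul, abs_of_nonneg h0]
    exact mul_le_mul_of_nonneg_left (abs_mulVec_le (trans_nonneg M (opt o)) (trans_sum M (opt o))
      (v := fun s' => uOpt opt q s' o - uOpt opt q' s' o)
      (fun s' => dist_uOpt_le opt q q' s' o) s) h0
  exact ⟨hT.fixedPoint T, fun s o => (congrFun (congrFun hT.fixedPoint_isFixedPt s) o).symm⟩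

variable [DecidableEq S] [DecidableEq O]

/-- Following `μ` for `n` steps and then collecting `q` yields at most `q`. Since the return is `n *
(r - c)` up to a bounded term, `r > c` is impossible. -/
theorem rewardRate_le [Nonempty S] (hlen : ∀ s o, FiniteMeanLength M (opt o) s)
    (huni : ∀ μ : Policy S O, IsUnichain (inducedChain M opt μ)) (μ : Policy S O)
    {c : ℝ} {q : S → O → ℝ} (hq : OptimalityEq M opt c q) : rewardRate M opt μ ≤ c := by
  obtain ⟨r, v, hv⟩ := exists_evaluationEq M opt μ hlen huni
  rw [rewardRate_eq M opt μ hlen hv]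
  have hP := intraStep_nonneg M opt μ
  have hP1 := intraStep_sum M opt μ
  have h1 : ∀ n : ℕ, ∀ x : S × O, expectedReturn M opt μ c x.1 x.2 n +
      (intraStep M opt μ ^ n).mulVec (fun x => q x.1 x.2) x ≤ q x.1 x.2 := by
    intro n
    induction n with
    | zero => simp [expectedReturn]
    | succ n ih =>
      rintro ⟨s, o⟩
      have h2 := mulVec_mono hP ih (s, o)
      have h3 : (intraStep M opt μ).mulVec (fun x : S × O => expectedReturn M opt μ c x.1 x.2 n +
          (intraStep M opt μ ^ n).mulVec (fun x => q x.1 x.2) x) (s, o) =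
          (intraStep M opt μ).mulVec (fun x => expectedReturn M opt μ c x.1 x.2 n) (s, o) +
            (intraStep M opt μ ^ (n + 1)).mulVec (fun x => q x.1 x.2) (s, o) := by
        rw [pow_succ', ← Matrix.mulVec_mulVec, ← Pi.add_apply, ← Matrix.mulVec_add]
        rfl
      rw [h3] at h2
      have h4 : (intraStep M opt μ).mulVec (fun x => q x.1 x.2) (s, o) ≤
          ∑ s', trans M (opt o) s s' * uOpt opt q s' o := by
        rw [intraStep_mulVec]
        exact Finset.sum_le_sum fun s' _ =>
          mul_le_mul_of_nonneg_left (uEval_le_uOpt opt μ q s' o) (trans_nonneg M _ _ _)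
      have h5 := (intraOptionEq_iff M opt _ c q).1 hq s o
      rw [expectedReturn_succ]
      simp only
      linarith
  obtain ⟨B, -, hB⟩ := exists_abs_le fun x : S × O => q x.1 x.2
  obtain ⟨C, -, hC⟩ := exists_abs_le fun x : S × O => v x.1 x.2
  obtain ⟨x⟩ := ‹Nonempty S›.map2 Prod.mk ‹Nonempty O›
  have h6 : ∀ n : ℕ, n * (r - c) ≤ B + B + (C + C) := fun n => by
    have e1 := h1 n x
    rw [expectedReturn_eq M opt μ hv] at e1
    have e2 := abs_le.1 (hB x)
    have e3 := abs_le.1 (hC x)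
    have e4 := abs_le.1 (abs_pow_mulVec_le hP hP1 hB n x)
    have e5 := abs_le.1 (abs_pow_mulVec_le hP hP1 hC n x)
    simp only [Prod.mk.eta] at e1
    linarith
  by_contra hlt
  push Not at hlt
  obtain ⟨n, hn⟩ := exists_nat_gt ((B + B + (C + C)) / (r - c))
  have := (div_lt_iff₀ (sub_pos.2 hlt)).1 hn
  linarith [h6 n]

theorem rewardRate_of_isGreedy [Nonempty S] (hlen : ∀ s o, FiniteMeanLength M (opt o) s)
    {μ : Policy S O} {c : ℝ} {q : S → O → ℝ} (hq : OptimalityEq M opt c q) (h : IsGreedy μ q) :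
    rewardRate M opt μ = c :=
  rewardRate_eq M opt μ hlen (hq.evaluationEq M opt h)

/-- A deterministic greedy policy attains the upper bound `c`, so the supremum is a maximum. -/
theorem optimalRate_eq [Nonempty S] (hlen : ∀ s o, FiniteMeanLength M (opt o) s)
    (huni : ∀ μ : Policy S O, IsUnichain (inducedChain M opt μ))
    {c : ℝ} {q : S → O → ℝ} (hq : OptimalityEq M opt c q) : c = optimalRate M opt := by
  obtain ⟨δ, hδ⟩ := exists_greedy q
  have h1 := rewardRate_of_isGreedy M opt hlen hq (isGreedy_deterministic hδ)
  have h2 : IsGreatest (Set.range fun μ : Policy S O => rewardRate M opt μ) c :=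
    ⟨⟨_, h1⟩, by
      rintro _ ⟨μ, rfl⟩
      exact rewardRate_le M opt hlen huni μ hq⟩
  exact h2.csSup_eq.symm

/-- Solutions of the optimality equation differ by constants. -/
theorem OptimalityEq.exists_const [Nonempty S] (hlen : ∀ s o, FiniteMeanLength M (opt o) s)
    (huni : ∀ μ : Policy S O, IsUnichain (inducedChain M opt μ)) {c : ℝ} {q₁ q₂ : S → O → ℝ}
    (hq₁ : OptimalityEq M opt c q₁) (hq₂ : OptimalityEq M opt c q₂) :
    ∃ b, ∀ s o, q₂ s o = q₁ s o + b := by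
  -- Rewards and `c` cancel, so the difference of the solutions is determined by the difference of
  -- their maxima at termination.
  have key : ∀ s o, q₂ s o - q₁ s o =
      ∑ s', termProb M (opt o) s s' * (maxValue q₂ s' - maxValue q₁ s') := fun s o =>
    eq_termProb_sum M (opt o) (fun s => hlen s o) _ (fun s => q₂ s o - q₁ s o) (fun s => by
      rw [(intraOptionEq_iff M opt _ c q₁).1 hq₁ s o, (intraOptionEq_iff M opt _ c q₂).1 hq₂ s o,
        add_sub_add_left_eq_sub, ← Finset.sum_sub_distrib]
      refine Finset.sum_congr rfl fun x _ => ?_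
      rw [uOpt_eq, uOpt_eq]
      ring) s
  have hdet : ∀ (δ : S → O) (s : S), ∑ s', inducedChain M opt (Policy.deterministic δ) s s' *
      (maxValue q₂ s' - maxValue q₁ s') = q₂ s (δ s) - q₁ s (δ s) := fun δ s => by
    rw [inducedChain_average]
    simp only [← key]
    simp [Policy.deterministic]
  obtain ⟨δ₁, h₁⟩ := exists_greedy q₁
  obtain ⟨δ₂, h₂⟩ := exists_greedy q₂
  -- A choice greedy for `q₂` may be suboptimal for `q₁`, giving subharmonicity; the reverse holds
  -- for `δ₁`.
  obtain ⟨b, hb⟩ := exists_const_of_sub_super M opt hlen huni (Policy.deterministic δ₂)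
    (Policy.deterministic δ₁) (fun s => maxValue q₂ s - maxValue q₁ s)
    (fun s => by
      rw [hdet, h₂]
      linarith [le_maxValue q₁ s (δ₂ s)])
    (fun s => by
      rw [hdet, h₁]
      linarith [le_maxValue q₂ s (δ₁ s)])
  refine ⟨b, fun s o => ?_⟩
  have := key s o
  simp only [hb, ← Finset.sum_mul, termProb_sum M (opt o) (fun s => hlen s o), one_mul] at this
  linarith

/-- The optimality equation is solvable: after subtraction of the diverging constants, solutions
of the discounted equations stay bounded as the discount factor tends to one. -/
theorem exists_optimalityEq [Nonempty S] (hlen : ∀ s o, FiniteMeanLength M (opt o) s)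
    (huni : ∀ μ : Policy S O, IsUnichain (inducedChain M opt μ)) :
    ∃ (c : ℝ) (q : S → O → ℝ), OptimalityEq M opt c q := by
  -- The greedy policy below depends on `γ`, but there are finitely many deterministic ones, so `C`
  -- and `D` bound their rates and values uniformly in `γ`.
  choose r v hv using fun δ : S → O =>
    exists_evaluationEq M opt (Policy.deterministic δ) hlen huni
  choose B hB0 hB using fun δ : S → O => exists_abs_le fun x : S × O => v δ x.1 x.2
  obtain ⟨C, -, hC⟩ := exists_abs_le r
  obtain ⟨D, hD0, hD⟩ := exists_abs_le B
  have step : ∀ γ : ℝ, 0 ≤ γ → γ < 1 → ∃ (c : ℝ) (w : S → O → ℝ), |c| ≤ C ∧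
      dist w 0 ≤ D + D ∧ ∀ s o, w s o = stepReward M (opt o) s - c +
        γ * ∑ s', trans M (opt o) s s' * uOpt opt w s' o := by
    intro γ h0 h1
    obtain ⟨q, hq⟩ := exists_discounted M opt h0 h1
    obtain ⟨δ, hδ⟩ := exists_greedy q
    have hg : (1 - γ) ≠ 0 := (sub_pos.2 h1).ne'
    -- A shift by `k` contributes `(1 - γ) * k` to the equation, so this one introduces exactly the
    -- rate `r δ` of the greedy policy.
    let w : S → O → ℝ := fun s o => q s o + -(r δ / (1 - γ))
    have hw : ∀ s o, w s o = stepReward M (opt o) s - r δ +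
        γ * ∑ s', trans M (opt o) s s' * uOpt opt w s' o := fun s o => by
      simp only [w, uOpt_add_const, mul_add, Finset.sum_add_distrib, ← Finset.sum_mul, trans_sum]
      rw [hq s o]
      field_simp
      ring
    have hgr : IsGreedy (Policy.deterministic δ) w := isGreedy_deterministic fun s => by
      rw [maxValue_add_const, ← hδ]
    set P := intraStep M opt (Policy.deterministic δ) with hPdef
    have hP := intraStep_nonneg M opt (Policy.deterministic δ)
    have hP1 := intraStep_sum M opt (Policy.deterministic δ)
    let W : S × O → ℝ := fun x => w x.1 x.2
    let V : S × O → ℝ := fun x => v δ x.1 x.2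
    -- `V` solves the undiscounted equation for the same policy and rate, so the mismatch is only
    -- `(1 - γ) * P V`. At the maximum of `|W - V|` the factor `1 - γ` cancels, leaving a bound free
    -- of `γ`.
    have hWV : ∀ x, W x - V x = γ * P.mulVec (W - V) x - (1 - γ) * P.mulVec V x := fun x => by
      have e1 := (evaluationEq_iff M opt _ _ _).1 (hv δ) x
      have e2 := intraStep_mulVec M opt (Policy.deterministic δ) W x.1 x.2
      have e3 := hw x.1 x.2
      rw [← uEval_eq_uOpt_of_isGreedy opt hgr] at e3
      change w x.1 x.2 - v δ x.1 x.2 = _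
      rw [Matrix.mulVec_sub, Pi.sub_apply, e3, e1]
      change _ = γ * (P.mulVec W (x.1, x.2) - _) - _
      rw [hPdef, e2]
      ring
    obtain ⟨x, hx⟩ := Finite.exists_max fun x => |W x - V x|
    have hbound : |W x - V x| ≤ B δ := by
      have e1 : |W x - V x| ≤ γ * |W x - V x| + (1 - γ) * B δ := by
        conv_lhs => rw [hWV x]
        refine (abs_sub _ _).trans ?_
        rw [abs_mul, abs_mul, abs_of_nonneg h0, abs_of_pos (sub_pos.2 h1)]
        exact add_le_add (mul_le_mul_of_nonneg_left (abs_mulVec_le hP hP1 hx x) h0)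
          (mul_le_mul_of_nonneg_left (abs_mulVec_le hP hP1 (hB δ) x) (sub_pos.2 h1).le)
      have e2 : (1 - γ) * |W x - V x| ≤ (1 - γ) * B δ := by linarith
      exact le_of_mul_le_mul_left e2 (sub_pos.2 h1)
    refine ⟨r δ, w, hC δ, ?_, hw⟩
    have hDD : 0 ≤ D + D := by linarith
    refine (dist_pi_le_iff hDD).2 fun s => (dist_pi_le_iff hDD).2 fun o => ?_
    have e1 := (hx (s, o)).trans hbound
    have e2 := hB δ (s, o)
    have e3 := (le_abs_self _).trans (hD δ)
    simp only [Pi.zero_apply, dist_zero_right, Real.norm_eq_abs]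
    calc |w s o| = |(W (s, o) - V (s, o)) + V (s, o)| := by simp [W]
      _ ≤ _ := (abs_add_le _ _).trans (add_le_add (e1.trans e3) (e2.trans e3))
  let γ : ℕ → ℝ := fun n => 1 - 1 / ((n : ℝ) + 1)
  have hγ0 : ∀ n, 0 ≤ γ n := fun n => by
    have : 1 / ((n : ℝ) + 1) ≤ 1 :=
      (div_le_one (by positivity)).2 (by linarith [(n.cast_nonneg : (0 : ℝ) ≤ n)])
    simp only [γ]
    linarith
  have hγ1 : ∀ n, γ n < 1 := fun n => sub_lt_self _ (by positivity)
  have hγ : Tendsto γ atTop (𝓝 1) := by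
    simpa only [sub_zero] using (tendsto_one_div_add_atTop_nhds_zero_nat (𝕜 := ℝ)).const_sub 1
  choose c w hc hw heq using fun n => step (γ n) (hγ0 n) (hγ1 n)
  have hcpt : IsCompact (Metric.closedBall (0 : ℝ) C ×ˢ
      Metric.closedBall (0 : S → O → ℝ) (D + D)) :=
    (isCompact_closedBall _ _).prod (isCompact_closedBall _ _)
  -- Along a subsequence the rates and shifted values converge, and the limit solves the equation
  -- with `γ = 1`.
  obtain ⟨⟨c', q⟩, -, φ, hφ, hlim⟩ := hcpt.tendsto_subseq (x := fun n => (c n, w n)) fun n =>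
    ⟨by simpa using hc n, hw n⟩
  have hlim1 : Tendsto (fun n => c (φ n)) atTop (𝓝 c') :=
    (continuous_fst.tendsto _).comp hlim
  have hlim2 : Tendsto (fun n => w (φ n)) atTop (𝓝 q) :=
    (continuous_snd.tendsto _).comp hlim
  have hu : ∀ s o, Tendsto (fun n => uOpt opt (w (φ n)) s o) atTop (𝓝 (uOpt opt q s o)) :=
    fun s o => tendsto_iff_dist_tendsto_zero.2 (squeeze_zero (fun _ => dist_nonneg)
      (fun n => dist_uOpt_le opt (w (φ n)) q s o) (tendsto_iff_dist_tendsto_zero.1 hlim2))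
  refine ⟨c', q, (intraOptionEq_iff M opt _ c' q).2 fun s o => ?_⟩
  have hl : Tendsto (fun n => w (φ n) s o) atTop (𝓝 (q s o)) :=
    tendsto_pi_nhds.1 (tendsto_pi_nhds.1 hlim2 s) o
  have hr := (hlim1.const_sub (stepReward M (opt o) s)).add
    ((hγ.comp hφ.tendsto_atTop).mul (tendsto_finsetSum Finset.univ fun s' _ =>
      (hu s' o).const_mul (trans M (opt o) s s')))
  rw [one_mul] at hr
  exact tendsto_nhds_unique hl (hr.congr fun n => (heq (φ n) s o).symm)

end Optimality

end

end AvgOptions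

/-! ### The main theorem -/

theorem theorem2 {S A O : Type*} [Fintype S] [Fintype A] [Fintype O]
    [DecidableEq S] [DecidableEq O] [Nonempty S] [Nonempty O]
    (M : FiniteMDP S A) (opt : O → TemporalOption S A)
    (hlen : ∀ s o, FiniteMeanLength M (opt o) s)
    (hunichain : ∀ μ : Policy S O, IsUnichain (inducedChain M opt μ)) :
    -- the reward rates, the optimal reward rate and the differential values are well defined
    ((∀ (μ : Policy S O) (s : S) (o : O),
        Tendsto (optionRatio M opt μ s o) atTop (𝓝 (rewardRate M opt μ)) ∧
        Tendsto (fun t : ℕ => expectedReturn M opt μ 0 s o t / t) atTop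
          (𝓝 (rewardRate M opt μ)) ∧
        Tendsto (cesaroReturn M opt μ s o) atTop (𝓝 (diffValue M opt μ s o))) ∧
      BddAbove (Set.range fun μ : Policy S O => rewardRate M opt μ)) ∧
    -- the optimality equation
    ((∃ (rbar : ℝ) (q : S → O → ℝ), OptimalityEq M opt rbar q) ∧
      (∀ (rbar : ℝ) (q : S → O → ℝ), OptimalityEq M opt rbar q → rbar = optimalRate M opt) ∧
      (∀ (rbar₁ : ℝ) (q₁ : S → O → ℝ), OptimalityEq M opt rbar₁ q₁ →
        {q : S → O → ℝ | ∃ rbar : ℝ, OptimalityEq M opt rbar q} =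
          {q : S → O → ℝ | ∃ c : ℝ, ∀ s o, q s o = q₁ s o + c}) ∧
      (∀ (rbar : ℝ) (q : S → O → ℝ) (μ : Policy S O), OptimalityEq M opt rbar q →
        IsGreedy μ q → rewardRate M opt μ = optimalRate M opt)) ∧
    -- the evaluation equation
    (∀ μ : Policy S O,
      (∃ (rbar : ℝ) (q : S → O → ℝ), EvaluationEq M opt μ rbar q) ∧
      (∀ (rbar : ℝ) (q : S → O → ℝ), EvaluationEq M opt μ rbar q →
        rbar = rewardRate M opt μ) ∧
      {q : S → O → ℝ | ∃ rbar : ℝ, EvaluationEq M opt μ rbar q} =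
        {q : S → O → ℝ | ∃ c : ℝ, ∀ s o, q s o = diffValue M opt μ s o + c}) := by
  refine ⟨⟨fun μ s o => ?_, ?_⟩, ⟨exists_optimalityEq M opt hlen hunichain,
    fun c q hq => optimalRate_eq M opt hlen hunichain hq, fun c₁ q₁ hq₁ => ?_,
    fun c q μ hq hμ => (rewardRate_of_isGreedy M opt hlen hq hμ).trans
      (optimalRate_eq M opt hlen hunichain hq)⟩,
    fun μ => ⟨exists_evaluationEq M opt μ hlen hunichain,
      fun c q hq => (rewardRate_eq M opt μ hlen hq).symm, ?_⟩⟩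
  · obtain ⟨c, q, hq⟩ := exists_evaluationEq M opt μ hlen hunichain
    obtain ⟨b, hb⟩ := exists_tendsto_cesaroReturn M opt μ hlen hunichain hq
    have hd : diffValue M opt μ s o = q s o - b := (hb s o).limUnder_eq
    rw [rewardRate_eq M opt μ hlen hq, hd]
    exact ⟨tendsto_optionRatio M opt μ hlen hq s o, tendsto_expectedReturn_div M opt μ hq s o,
      hb s o⟩
  · obtain ⟨c, q, hq⟩ := exists_optimalityEq M opt hlen hunichain
    refine ⟨c, ?_⟩
    rintro _ ⟨μ, rfl⟩
    exact rewardRate_le M opt hlen hunichain μ hq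
  · ext q
    constructor
    · rintro ⟨c, hq⟩
      -- Both constants equal the optimal rate, so `q` and `q₁` solve the equation for the same
      -- constant, as `exists_const` requires.
      rw [optimalRate_eq M opt hlen hunichain hq,
        ← optimalRate_eq M opt hlen hunichain hq₁] at hq
      exact hq₁.exists_const M opt hlen hunichain hq
    · rintro ⟨b, hb⟩
      have : q = fun s o => q₁ s o + b := funext fun s => funext fun o => hb s o
      exact ⟨c₁, this ▸ hq₁.add_const M opt b⟩
  · obtain ⟨c, q₁, hq₁⟩ := exists_evaluationEq M opt μ hlen hunichain
    obtain ⟨b, hb⟩ := exists_diffValue_eq M opt μ hlen hunichain hq₁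
    ext q
    constructor
    · rintro ⟨c', hq⟩
      -- Every solution differs from `diffValue` by a constant, so two solutions need not be
      -- compared directly.
      obtain ⟨b', hb'⟩ := exists_diffValue_eq M opt μ hlen hunichain hq
      exact ⟨b', fun s o => by rw [hb' s o, sub_add_cancel]⟩
    · rintro ⟨d, hd⟩
      refine ⟨c, (evaluationEq_iff M opt μ c q).2 fun x => ?_⟩
      have h := (evaluationEq_iff M opt μ c q₁).1 hq₁ x
      have hfun : (fun x : S × O => q x.1 x.2) = (fun x => q₁ x.1 x.2) + fun _ => d - b :=
        funext fun x => by
          simp only [Pi.add_apply, hd, hb]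
          ring
      rw [hfun, Matrix.mulVec_add, Pi.add_apply, mulVec_const_of_sum (intraStep_sum M opt μ),
        hd, hb]
      linarith
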